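/- Let $N,m$ be natural numbers and $\mathbb T^N=\mathbb R^N/\mathbb Z^N$; functions on $\mathbb T^N$ are identified with $\mathbb Z^N$-periodic functions on $\mathbb R^N$. Let $D(x)=(d_{ij}(x))_{1\le i,j\le m}$, where $d_{ij}:\mathbb T^N\to\mathbb R$ are continuous and, for all $x$ and $i$, $$d_{ii}(x)\ge 0,\qquad d_{ij}(x)\le 0\ (j\ne i),\qquad \sum_{j=1}^m d_{ij}(x)\ge 0 .$$ Assume that $D(x)$ is irreducible for every $x\in\mathbb T^N$: for every nonempty proper subset $I\subsetneq\{1,\dots,m\}$ there are $i\in I$ and $j\notin I$ with $d_{ij}(x)\neq 0$. For $i=1,\dots,m$ let $H_i(x,p)=F_i(x,p)-f_i(x)$, where $F_i:\mathbb T^N\times\mathbb R^N\to\mathbb R$ and $f_i:\mathbb T^N\to\mathbb R$ are continuous, $f_i\ge 0$ and, for every $x$, the function $F_i(x,\cdot)$ is convex and coercive ($F_i(x,p)\to+\infty$ as $|p|\to\infty$) with $F_i(x,p)\ge F_i(x,0)=0$ for all $p$. Assume that $$\mathbb F=\Big\{x\in\mathbb T^N:\ \sum_{i=1}^m f_i(x)=0\Big\}\neq\emptyset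 .$$ For $\lambda\in(0,1)$ consider the discounted system $$\lambda v_i+H_i(x,Dv_i)+\sum_{j=1}^m d_{ij}(x)v_j=0\quad\text{in }\mathbb T^N,\ 1\le i\le m,\tag{1}$$ and, for $c\in\mathbb R^m$, the ergodic system $$H_i(x,Dv_i)+\sum_{j=1}^m d_{ij}(x)v_j=c_i\quad\text{in }\mathbb T^N,\ 1\le i\le m.\tag{2}$$ Solutions are continuous viscosity solutions $v:\mathbb T^N\to\mathbb R^m$: for each $i$ and each $C^1$ function $\varphi$, at every local maximum (respectively minimum) point $x$ of $v_i-\varphi$, the equation with index $i$, with $D\varphi(x)$ in place of $Dv_i$ and with the values $v_j(x)$, holds with $\le$ (respectively $\ge$). Then: 1. For every $\lambda\in(0,1)$ the system (1) has a unique solution $v^\lambda$. 2. Let $x^*\in\mathbb F$. Every sequence in $(0,1)$ converging to $0$ has a subsequence along which $$-\lambda v^\lambda\to c\in\mathbb R^m\quad\text{and}\quad v^\lambda-v^\lambda(x^*)\to v\quad\text{uniformly on }\mathbb T^N,$$ where $(c,v)$ solves (2), $v$ is Lipschitz continuous, $c\in\ker D(x)$ for all $x\in\mathbb T^N$, $v_i(x)=0$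 for all $x\in\mathbb F$ and $1\le i\le m$, and $c=0$. 3. The vector $c=(0,\dots,0)$ is the unique constant vector $c\in\mathbb R^m$ with $c\in\ker D(x)$ for all $x\in\mathbb T^N$ for which (2) has a solution. -/

import Mathlib

open Filter Topology

namespace HJSystem

/-- The Euclidean space `ℝ^N`. Functions on the flat torus `𝕋^N = ℝ^N / ℤ^N` are represented by the
`ℤ^N`-periodic functions on it. -/
abbrev E (N : ℕ) : Type := EuclideanSpace ℝ (Fin N)

/-- `g` is `1`-periodic in each coordinate, i.e. invariant under translations by `ℤ^N`. -/
def ZPeriodic {N : ℕ} {α : Type*} (g : E N → α) : Prop :=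
  ∀ (x : E N) (k : Fin N → ℤ), g (x + WithLp.toLp 2 (fun j => (k j : ℝ))) = g x

/-- The standing assumptions on the coupling matrix `D(x) = (d_ij(x))`. -/
structure IsCoupling {N m : ℕ} (D : E N → Matrix (Fin m) (Fin m) ℝ) : Prop where
  continuous : ∀ i j, Continuous fun x => D x i j
  periodic : ∀ i j, ZPeriodic fun x => D x i j
  diag_nonneg : ∀ x i, 0 ≤ D x i i
  offDiag_nonpos : ∀ x i j, i ≠ j → D x i j ≤ 0
  rowSum_nonneg : ∀ x i, 0 ≤ ∑ j, D x i j

/-- Irreducibility of a square matrix: every nonempty proper set of indices is linked to its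
complement by a nonzero entry. -/
def IsIrreducibleMatrix {m : ℕ} (A : Matrix (Fin m) (Fin m) ℝ) : Prop :=
  ∀ I : Set (Fin m), I.Nonempty → I ≠ Set.univ → ∃ i ∈ I, ∃ j ∉ I, A i j ≠ 0

/-- The structural assumptions on `F_i` and `f_i`, where `H_i(x,p) = F_i(x,p) - f_i(x)`. -/
structure IsStructured {N m : ℕ} (F : Fin m → E N → E N → ℝ) (f : Fin m → E N → ℝ) : Prop where
  continuous_F : ∀ i, Continuous fun q : E N × E N => F i q.1 q.2
  continuous_f : ∀ i, Continuous (f i)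
  periodic_F : ∀ i p, ZPeriodic fun x => F i x p
  periodic_f : ∀ i, ZPeriodic (f i)
  convex : ∀ i x, ConvexOn ℝ Set.univ (F i x)
  coercive : ∀ i x, Tendsto (F i x) (cocompact (E N)) atTop
  F_zero : ∀ i x, F i x 0 = 0
  F_nonneg : ∀ i x p, 0 ≤ F i x p
  f_nonneg : ∀ i x, 0 ≤ f i x

/-- The Hamiltonians `H_i(x,p) = F_i(x,p) - f_i(x)`. -/
def hamiltonian {N m : ℕ} (F : Fin m → E N → E N → ℝ) (f : Fin m → E N → ℝ) :
    Fin m → E N → E N → ℝ :=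
  fun i x p => F i x p - f i x

/-- The set where `∑ f_i` vanishes; for nonnegative `f_i`, the common zero set of the `f_i`. -/
def zeroSet {N m : ℕ} (f : Fin m → E N → ℝ) : Set (E N) :=
  {x | ∑ i, f i x = 0}

/-- Periodic viscosity subsolutions of
`l u_i + H_i(x, Du_i) + ∑_j d_ij(x) u_j = c_i`, `1 ≤ i ≤ m`. -/
structure IsSubsolution {N m : ℕ} (H : Fin m → E N → E N → ℝ)
    (D : E N → Matrix (Fin m) (Fin m) ℝ) (l : ℝ) (c : Fin m → ℝ) (u : E N → Fin m → ℝ) :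
    Prop where
  usc : ∀ i, UpperSemicontinuous fun x => u x i
  periodic : ZPeriodic u
  test : ∀ (i : Fin m) (φ : E N → ℝ) (x : E N), ContDiff ℝ 1 φ →
    IsLocalMax (fun y => u y i - φ y) x →
    l * u x i + H i x (gradient φ x) + ∑ j, D x i j * u x j ≤ c i

/-- Periodic viscosity supersolutions of
`l u_i + H_i(x, Du_i) + ∑_j d_ij(x) u_j = c_i`, `1 ≤ i ≤ m`. -/
structure IsSupersolution {N m : ℕ} (H : Fin m → E N → E N → ℝ)
    (D : E N → Matrix (Fin m) (Fin m) ℝ) (l : ℝ) (c : Fin m → ℝ) (u : E N → Fin m → ℝ) :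
    Prop where
  lsc : ∀ i, LowerSemicontinuous fun x => u x i
  periodic : ZPeriodic u
  test : ∀ (i : Fin m) (φ : E N → ℝ) (x : E N), ContDiff ℝ 1 φ →
    IsLocalMin (fun y => u y i - φ y) x →
    c i ≤ l * u x i + H i x (gradient φ x) + ∑ j, D x i j * u x j

/-- Continuous periodic viscosity solutions of
`l u_i + H_i(x, Du_i) + ∑_j d_ij(x) u_j = c_i`, `1 ≤ i ≤ m`. -/
structure IsSolution {N m : ℕ} (H : Fin m → E N → E N → ℝ)
    (D : E N → Matrix (Fin m) (Fin m) ℝ) (l : ℝ) (c : Fin m → ℝ) (u : E N → Fin m → ℝ) :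
    Prop where
  continuous : Continuous u
  sub : IsSubsolution H D l c u
  super : IsSupersolution H D l c u

/-- The discounted system `l v_i + H_i(x, Dv_i) + ∑_j d_ij(x) v_j = 0` on the torus. -/
def IsDiscountedSolution {N m : ℕ} (H : Fin m → E N → E N → ℝ)
    (D : E N → Matrix (Fin m) (Fin m) ℝ) (l : ℝ) (v : E N → Fin m → ℝ) : Prop :=
  IsSolution H D l 0 v

/-- The ergodic system `H_i(x, Dv_i) + ∑_j d_ij(x) v_j = c_i` on the torus. -/
def IsErgodicSolution {N m : ℕ} (H : Fin m → E N → E N → ℝ)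
    (D : E N → Matrix (Fin m) (Fin m) ℝ) (c : Fin m → ℝ) (v : E N → Fin m → ℝ) : Prop :=
  IsSolution H D 0 c v

end HJSystem

/-!
Everything rests on two features of the system. Coercivity makes bounded subsolutions Lipschitz
(`SubTest.lipschitzWith`), and `F ≥ 0` makes every bounded continuous subsolution satisfy the
algebraic inequality `l u_i + (D u)_i ≤ f_i + c_i` at every point (`SubTest.pointwise`), because
touching points are dense.

*Well-posedness.* Existence is Perron's method between the constant subsolution `0` and a large
constant supersolution. The bounded subsolutions are equi-Lipschitz, so their supremum is a
continuous subsolution, and a bump at a point where the supersolution inequality fails would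
contradict maximality (`exists_bump`). Uniqueness is the doubling of variables
(`SubTest.le_of_superTest`): Lipschitz continuity of one function keeps the gradients at the doubled
maxima bounded, so that continuity of `H` suffices, and the sign structure of `D` together with
`l > 0` gives the contradiction. In particular the solutions are nonnegative.

*Vanishing discount.* At a point of the zero set the algebraic inequality reads `(l + D) u ≤ 0` with
`u ≥ 0`, and the maximum principle for `D` gives `u = 0` there. Elsewhere it gives `D u ≤ f`, and
irreducibility with compactness bounds the differences `u_i - u_j` independently of `l`
(`IsCoupling.exists_osc_bound`). The coupling term is therefore bounded from below, the solutions
are Lipschitz uniformly in `l`, and, vanishing on the zero set, they are uniformly bounded.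
Arzelà–Ascoli and stability of viscosity inequalities provide a limit, with ergodic constant zero.

*Uniqueness of the constant.* A nonzero vector in the kernel of all the `D(x)` is, by
irreducibility, a constant vector, and then all row sums vanish. A positive constant contradicts
the supersolution inequality at a global minimum of the ergodic solution over points and indices; a
negative one contradicts the algebraic inequality at a point of the zero set.
-/

namespace HJSystem

/-! ### Periodic functions -/

/-- Translation of a point into a fixed ball by an integer vector (its coordinatewise fractional
part): a concrete substitute for the compactness of the torus. -/
noncomputable def fractPoint {N : ℕ} (x : E N) : E N :=
  x + WithLp.toLp 2 (fun j => ((-⌊x j⌋ : ℤ) : ℝ))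

theorem norm_fractPoint_le {N : ℕ} (x : E N) : ‖fractPoint x‖ ≤ √N := by
  rw [EuclideanSpace.norm_eq]
  apply Real.sqrt_le_sqrt
  calc ∑ j, ‖fractPoint x j‖ ^ 2 ≤ ∑ _j : Fin N, (1 : ℝ) := by
        apply Finset.sum_le_sum
        intro j _
        have h : fractPoint x j = Int.fract (x j) := by
          simp [fractPoint, Int.fract, sub_eq_add_neg]
        rw [h, Real.norm_eq_abs, Int.abs_fract]
        exact pow_le_one₀ (Int.fract_nonneg _) (Int.fract_lt_one _).le
    _ = N := by simp

theorem fractPoint_mem {N : ℕ} (x : E N) : fractPoint x ∈ Metric.closedBall (0 : E N) √N := by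
  simpa using norm_fractPoint_le x

theorem ZPeriodic.fractPoint_eq {N : ℕ} {α : Type*} {g : E N → α} (hg : ZPeriodic g) (x : E N) :
    g (fractPoint x) = g x := hg x _

theorem ZPeriodic.apply {N : ℕ} {ι α : Type*} {g : E N → ι → α} (hg : ZPeriodic g) (i : ι) :
    ZPeriodic fun x => g x i := fun x k => congrFun (hg x k) i

/-- A finite family of continuous periodic functions is uniformly bounded. -/
theorem ZPeriodic.exists_bound {N : ℕ} {ι : Type*} [Finite ι] {g : ι → E N → ℝ}
    (hc : ∀ i, Continuous (g i)) (hg : ∀ i, ZPeriodic (g i)) :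
    ∃ B, 0 ≤ B ∧ ∀ i x, |g i x| ≤ B := by
  have h : ∀ i, ∃ B, ∀ x, |g i x| ≤ B := by
    intro i
    obtain ⟨B, hB⟩ := (isCompact_closedBall (0 : E N) √N).exists_bound_of_continuousOn
      (hc i).continuousOn
    exact ⟨B, fun x => by
      rw [← (hg i).fractPoint_eq x]
      exact hB _ (fractPoint_mem x)⟩
  choose B hB using h
  obtain ⟨B', hB'⟩ := (Set.finite_range B).bddAbove
  exact ⟨max B' 0, le_max_right _ _, fun i x =>
    (hB i x).trans ((hB' ⟨i, rfl⟩).trans (le_max_left _ _))⟩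

/-- A continuous periodic function attains its minimum. -/
theorem ZPeriodic.exists_min {N : ℕ} {g : E N → ℝ}
    (hc : Continuous g) (hg : ZPeriodic g) : ∃ x, ∀ y, g x ≤ g y := by
  obtain ⟨x, -, hx⟩ := (isCompact_closedBall (0 : E N) √N).exists_isMinOn
    ⟨0, by simp⟩ hc.continuousOn
  exact ⟨x, fun y => by
    rw [← hg.fractPoint_eq y]
    exact hx (fractPoint_mem y)⟩

/-! ### Uniform coercivity -/

/-- Convexity in `p` and `F x 0 = 0` propagate a lower bound on a sphere to its exterior, so that
pointwise coercivity is locally uniform in `x`. -/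
theorem exists_uniform_coercivity_bound {N : ℕ} {F : E N → E N → ℝ}
    (hc : Continuous fun q : E N × E N => F q.1 q.2) (hp : ∀ p, ZPeriodic fun x => F x p)
    (hconv : ∀ x, ConvexOn ℝ Set.univ (F x)) (hcoer : ∀ x, Tendsto (F x) (cocompact (E N)) atTop)
    (h0 : ∀ x, F x 0 = 0) {C : ℝ} (hC : 0 ≤ C) :
    ∃ R, ∀ x p, F x p ≤ C → ‖p‖ ≤ R := by
  suffices h : ∃ R, ∀ x ∈ Metric.closedBall (0 : E N) √N, ∀ p, F x p ≤ C → ‖p‖ ≤ R by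
    obtain ⟨R, hR⟩ := h
    exact ⟨R, fun x p hxp => hR _ (fractPoint_mem x) p (by rwa [(hp p).fractPoint_eq x])⟩
  refine (isCompact_closedBall (0 : E N) √N).induction_on
    (p := fun s => ∃ R, ∀ x ∈ s, ∀ p, F x p ≤ C → ‖p‖ ≤ R) ⟨0, by simp⟩
    (fun s t hst ⟨R, hR⟩ => ⟨R, fun x hx => hR x (hst hx)⟩) ?_ ?_
  · rintro s t ⟨R, hR⟩ ⟨R', hR'⟩
    refine ⟨max R R', ?_⟩
    rintro x (hx | hx) p hxp
    · exact (hR x hx p hxp).trans (le_max_left _ _)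
    · exact (hR' x hx p hxp).trans (le_max_right _ _)
  · intro x _
    obtain ⟨ρ, hρ⟩ : ∃ ρ, ∀ p : E N, ρ < ‖p‖ → C < F x p := by
      have := (hcoer x).eventually_gt_atTop C
      rw [← Metric.cobounded_eq_cocompact] at this
      obtain ⟨ρ, -, hρ⟩ := (Metric.hasBasis_cobounded_compl_closedBall (0 : E N)).mem_iff.1 this
      exact ⟨ρ, fun p hp => hρ (by simpa using hp)⟩
    set r : ℝ := max ρ 0 + 1 with hr
    have hr0 : 0 < r := by positivity
    have hrρ : ρ < r := (le_max_left ρ 0).trans_lt (lt_add_one _)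
    have hnear : ∀ᶠ y in 𝓝 x, ∀ p ∈ Metric.sphere (0 : E N) r, C < F y p := by
      refine (isCompact_sphere (0 : E N) r).eventually_forall_of_forall_eventually ?_
      intro p hp
      have hxp : C < F x p := hρ p (by rw [mem_sphere_zero_iff_norm.1 hp]; exact hrρ)
      exact (hc.tendsto (x, p)).eventually_const_lt hxp
    refine ⟨_, mem_nhdsWithin_of_mem_nhds hnear, r, ?_⟩
    intro y hy p hyp
    by_contra! hlt
    have hp0 : 0 < ‖p‖ := hr0.trans hlt
    have hmem : (r / ‖p‖) • p ∈ Metric.sphere (0 : E N) r := by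
      rw [mem_sphere_zero_iff_norm, norm_smul, Real.norm_of_nonneg (by positivity)]
      field_simp
    have h1 := hy _ hmem
    have hle : r / ‖p‖ ≤ 1 := (div_le_one hp0).2 hlt.le
    have h2 := (hconv y).2 (Set.mem_univ p) (Set.mem_univ 0)
      (show 0 ≤ r / ‖p‖ by positivity) (sub_nonneg.2 hle) (by ring)
    simp only [smul_zero, add_zero, h0, smul_eq_mul, mul_zero] at h2
    have h3 : r / ‖p‖ * F y p ≤ 1 * C :=
      mul_le_mul hle hyp (by
        by_contra! hneg
        have : r / ‖p‖ * F y p ≤ 0 := mul_nonpos_of_nonneg_of_nonpos (by positivity) hneg.le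
        linarith) zero_le_one
    linarith

/-! ### Gradients -/

theorem gradient_sub_of_contDiff {N : ℕ} {φ ψ : E N → ℝ} (hφ : ContDiff ℝ 1 φ)
    (hψ : ContDiff ℝ 1 ψ) (x : E N) :
    gradient (fun y => φ y - ψ y) x = gradient φ x - gradient ψ x := by
  unfold gradient
  rw [fderiv_fun_sub (hφ.differentiable one_ne_zero x) (hψ.differentiable one_ne_zero x), map_sub]

theorem gradient_add_of_contDiff {N : ℕ} {φ ψ : E N → ℝ} (hφ : ContDiff ℝ 1 φ)
    (hψ : ContDiff ℝ 1 ψ) (x : E N) :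
    gradient (fun y => φ y + ψ y) x = gradient φ x + gradient ψ x := by
  unfold gradient
  rw [fderiv_fun_add (hφ.differentiable one_ne_zero x) (hψ.differentiable one_ne_zero x), map_add]

theorem continuous_gradient {N : ℕ} {φ : E N → ℝ} (hφ : ContDiff ℝ 1 φ) :
    Continuous (gradient φ) :=
  (InnerProductSpace.toDual ℝ (E N)).symm.continuous.comp (hφ.continuous_fderiv one_ne_zero)

theorem gradient_eq_of_isLocalMax_sub {N : ℕ} {φ ψ : E N → ℝ} (hφ : ContDiff ℝ 1 φ)
    (hψ : ContDiff ℝ 1 ψ) {x : E N} (h : IsLocalMax (fun y => φ y - ψ y) x) :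
    gradient φ x = gradient ψ x := by
  have h1 := gradient_sub_of_contDiff hφ hψ x
  have h2 : gradient (fun y => φ y - ψ y) x = 0 := by
    unfold gradient
    rw [h.fderiv_eq_zero, map_zero]
  rw [h2] at h1
  exact (sub_eq_zero.1 h1.symm)

theorem contDiff_mul_norm_sq {N : ℕ} (a : ℝ) (x : E N) :
    ContDiff ℝ 1 fun y : E N => a * ‖y - x‖ ^ 2 :=
  contDiff_const.mul ((contDiff_id.sub contDiff_const).norm_sq ℝ)

theorem hasFDerivAt_norm_sub_sq {N : ℕ} (x y : E N) :
    HasFDerivAt (fun y : E N => ‖y - x‖ ^ 2) ((2 : ℝ) • innerSL ℝ (y - x)) y := by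
  refine ((hasFDerivAt_id y).sub_const x).norm_sq.congr_fderiv ?_
  ext z
  simp [two_smul]

theorem gradient_mul_norm_sq {N : ℕ} (a : ℝ) (x y : E N) :
    gradient (fun y : E N => a * ‖y - x‖ ^ 2) y = (2 * a) • (y - x) := by
  apply HasGradientAt.gradient
  rw [hasGradientAt_iff_hasFDerivAt]
  refine ((hasFDerivAt_norm_sub_sq x y).const_mul a).congr_fderiv (ContinuousLinearMap.ext ?_)
  intro z
  simp only [smul_apply, innerSL_apply_apply, smul_eq_mul,
    InnerProductSpace.toDual_apply_apply, real_inner_smul_left]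
  ring

theorem contDiff_mul_sqrt {N : ℕ} (K : ℝ) {ε : ℝ} (hε : 0 < ε) (x : E N) :
    ContDiff ℝ 1 fun y : E N => K * √(ε ^ 2 + ‖y - x‖ ^ 2) :=
  contDiff_const.mul ((contDiff_const.add ((contDiff_id.sub contDiff_const).norm_sq ℝ)).sqrt
    fun y => by positivity)

theorem gradient_mul_sqrt {N : ℕ} (K : ℝ) {ε : ℝ} (hε : 0 < ε) (x y : E N) :
    gradient (fun y : E N => K * √(ε ^ 2 + ‖y - x‖ ^ 2)) y =
      (K / √(ε ^ 2 + ‖y - x‖ ^ 2)) • (y - x) := by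
  apply HasGradientAt.gradient
  rw [hasGradientAt_iff_hasFDerivAt]
  refine ((((hasFDerivAt_norm_sub_sq x y).const_add (ε ^ 2)).sqrt
    (by positivity)).const_mul K).congr_fderiv (ContinuousLinearMap.ext ?_)
  intro z
  simp only [smul_apply, innerSL_apply_apply, smul_eq_mul,
    InnerProductSpace.toDual_apply_apply, real_inner_smul_left]
  field_simp

/-! ### Touching points and stability of viscosity inequalities -/

/-- The viscosity subsolution inequalities alone, without periodicity or semicontinuity. -/
def SubTest {N m : ℕ} (H : Fin m → E N → E N → ℝ) (D : E N → Matrix (Fin m) (Fin m) ℝ)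
    (l : ℝ) (c : Fin m → ℝ) (u : E N → Fin m → ℝ) : Prop :=
  ∀ (i : Fin m) (φ : E N → ℝ) (x : E N), ContDiff ℝ 1 φ →
    IsLocalMax (fun y => u y i - φ y) x →
    l * u x i + H i x (gradient φ x) + ∑ j, D x i j * u x j ≤ c i

/-- The viscosity supersolution inequalities alone, without periodicity or semicontinuity. -/
def SuperTest {N m : ℕ} (H : Fin m → E N → E N → ℝ) (D : E N → Matrix (Fin m) (Fin m) ℝ)
    (l : ℝ) (c : Fin m → ℝ) (u : E N → Fin m → ℝ) : Prop :=
  ∀ (i : Fin m) (φ : E N → ℝ) (x : E N), ContDiff ℝ 1 φ →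
    IsLocalMin (fun y => u y i - φ y) x →
    c i ≤ l * u x i + H i x (gradient φ x) + ∑ j, D x i j * u x j

theorem gradient_neg {N : ℕ} (φ : E N → ℝ) (x : E N) :
    gradient (fun y => -φ y) x = -gradient φ x := by
  unfold gradient
  rw [fderiv_fun_neg, map_neg]

/-- `u` is a supersolution for `H` if and only if `-u` is a subsolution for the reflected
Hamiltonian `-H(x, -p)`. -/
theorem superTest_iff_subTest_neg {N m : ℕ} {H : Fin m → E N → E N → ℝ}
    {D : E N → Matrix (Fin m) (Fin m) ℝ} {l : ℝ} {c : Fin m → ℝ} {u : E N → Fin m → ℝ} :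
    SuperTest H D l c u ↔
      SubTest (fun i x p => -H i x (-p)) D l (fun i => -c i) (fun x i => -u x i) := by
  constructor
  · intro h i φ x hφ hx
    have := h i (fun y => -φ y) x hφ.neg (by
      refine hx.neg.congr (Eventually.of_forall fun y => ?_)
      simp only
      ring)
    rw [gradient_neg] at this
    simp only [mul_neg, Finset.sum_neg_distrib]
    linarith
  · intro h i φ x hφ hx
    have := h i (fun y => -φ y) x hφ.neg (by
      refine hx.neg.congr (Eventually.of_forall fun y => ?_)
      simp only
      ring)
    rw [gradient_neg] at this
    simp only [mul_neg, Finset.sum_neg_distrib, neg_neg] at this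
    linarith

/-- If `u - φ` has a local maximum at `x`, and the continuous functions `v n` are asymptotically
below `u` and approximate it at `x`, then `v n - φ - |· - x|²` has local maxima converging to `x`,
with values of `v n` converging to `u x`. -/
theorem exists_isLocalMax_tendsto {N : ℕ} {u φ : E N → ℝ} {x : E N} (hφ : Continuous φ)
    (hmax : IsLocalMax (fun y => u y - φ y) x) {v : ℕ → E N → ℝ} (hv : ∀ n, Continuous (v n))
    (hle : ∀ ε > 0, ∀ᶠ n in atTop, ∀ y, v n y ≤ u y + ε)
    (hx : Tendsto (fun n => v n x) atTop (𝓝 (u x))) :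
    ∃ y : ℕ → E N, Tendsto y atTop (𝓝 x) ∧ Tendsto (fun n => v n (y n)) atTop (𝓝 (u x)) ∧
      ∀ᶠ n in atTop, IsLocalMax (fun z => v n z - (φ z + 1 * ‖z - x‖ ^ 2)) (y n) := by
  obtain ⟨r, hr, hball⟩ := Metric.nhds_basis_closedBall.mem_iff.1 hmax
  have hex : ∀ n, ∃ y ∈ Metric.closedBall x r,
      IsMaxOn (fun z => v n z - (φ z + 1 * ‖z - x‖ ^ 2)) (Metric.closedBall x r) y := fun n =>
    (isCompact_closedBall x r).exists_isMaxOn ⟨x, Metric.mem_closedBall_self hr.le⟩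
      (by have := hv n; fun_prop)
  choose y hyr hy using hex
  have hxy : ∀ n, v n x - φ x + ‖y n - x‖ ^ 2 ≤ v n (y n) - φ (y n) := by
    intro n
    have := hy n (Metric.mem_closedBall_self hr.le)
    simp only [Set.mem_ofPred_eq, sub_self, norm_zero] at this
    linarith
  have hu : ∀ n, u (y n) - φ (y n) ≤ u x - φ x := fun n => hball (hyr n)
  have hsq : Tendsto (fun n => ‖y n - x‖ ^ 2) atTop (𝓝 0) := by
    rw [Metric.tendsto_nhds]
    intro ε hε
    filter_upwards [hle (ε / 2) (half_pos hε), hx.eventually_const_lt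
      (show u x - ε / 2 < u x by linarith)] with n h1 h2
    rw [Real.dist_eq, sub_zero, abs_of_nonneg (by positivity)]
    linarith [h1 (y n), hxy n, hu n]
  have hyx : Tendsto y atTop (𝓝 x) := by
    rw [tendsto_iff_norm_sub_tendsto_zero]
    have := hsq.sqrt
    simpa using this
  have hφy : Tendsto (fun n => φ (y n)) atTop (𝓝 (φ x)) := (hφ.tendsto x).comp hyx
  refine ⟨y, hyx, ?_, ?_⟩
  · rw [Metric.tendsto_nhds]
    intro ε hε
    filter_upwards [hle (ε / 2) (half_pos hε), hx.eventually_const_lt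
      (show u x - ε / 2 < u x by linarith), hφy.eventually_const_lt
      (show φ x - ε / 2 < φ x by linarith), hφy.eventually_lt_const
      (show φ x < φ x + ε / 2 by linarith)] with n h1 h2 h3 h4
    rw [Real.dist_eq, abs_lt]
    have := sq_nonneg ‖y n - x‖
    constructor <;> linarith [h1 (y n), hxy n, hu n]
  · filter_upwards [hyx (Metric.ball_mem_nhds x hr)] with n h2
    exact (hy n).isLocalMax (mem_of_superset (Metric.isOpen_ball.mem_nhds h2)
      Metric.ball_subset_closedBall)

theorem gradient_add_mul_norm_sq {N : ℕ} {φ : E N → ℝ} (hφ : ContDiff ℝ 1 φ) (a : ℝ)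
    (x y : E N) :
    gradient (fun z => φ z + a * ‖z - x‖ ^ 2) y = gradient φ y + (2 * a) • (y - x) := by
  rw [gradient_add_of_contDiff hφ (contDiff_mul_norm_sq a x), gradient_mul_norm_sq]

/-- Along touching points converging to `x`, the perturbed gradients converge. -/
theorem tendsto_gradient_add_mul_norm_sq {N : ℕ} {φ : E N → ℝ} (hφ : ContDiff ℝ 1 φ) {x : E N}
    {y : ℕ → E N} (hy : Tendsto y atTop (𝓝 x)) (a : ℝ) :
    Tendsto (fun n => gradient (fun z => φ z + a * ‖z - x‖ ^ 2) (y n)) atTop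
      (𝓝 (gradient φ x)) := by
  simp_rw [gradient_add_mul_norm_sq hφ]
  have h1 := ((continuous_gradient hφ).tendsto x).comp hy
  have h2 : Tendsto (fun n => (2 * a) • (y n - x)) atTop (𝓝 ((2 * a) • (x - x))) :=
    (hy.sub_const x).const_smul _
  simpa using h1.add h2

/-- Stability of the subsolution inequalities under uniform convergence. -/
theorem SubTest.of_tendstoUniformly {N m : ℕ} {H : Fin m → E N → E N → ℝ}
    {D : E N → Matrix (Fin m) (Fin m) ℝ} {c : Fin m → ℝ}
    (hH : ∀ i, Continuous fun q : E N × E N => H i q.1 q.2)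
    (hD : ∀ i j, Continuous fun x => D x i j) {l : ℕ → ℝ} {l₀ : ℝ}
    (hl : Tendsto l atTop (𝓝 l₀)) {v : ℕ → E N → Fin m → ℝ} {u : E N → Fin m → ℝ}
    (hv : ∀ n, Continuous (v n)) (hu : Continuous u) (hvu : TendstoUniformly v u atTop)
    (hsub : ∀ n, SubTest H D (l n) c (v n)) : SubTest H D l₀ c u := by
  intro i φ x hφ hmax
  have hcomp : ∀ j, TendstoUniformly (fun n x => v n x j) (fun x => u x j) atTop := fun j =>
    (Pi.uniformContinuous_proj _ j).comp_tendstoUniformly hvu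
  obtain ⟨y, hyx, hvy, hloc⟩ := exists_isLocalMax_tendsto hφ.continuous hmax
    (v := fun n x => v n x i) (fun n => (continuous_apply i).comp (hv n))
    (fun ε hε => by
      filter_upwards [Metric.tendstoUniformly_iff.1 (hcomp i) ε hε] with n hn y
      have := hn y
      rw [Real.dist_eq, abs_lt] at this
      linarith)
    ((hcomp i).tendsto_at x)
  have hlim : ∀ j, Tendsto (fun n => v n (y n) j) atTop (𝓝 (u x j)) := fun j =>
    (hcomp j).tendsto_comp ((continuous_apply j).comp hu).continuousAt hyx
  have hg := tendsto_gradient_add_mul_norm_sq hφ hyx 1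
  have hH' := ((hH i).tendsto (x, gradient φ x)).comp (hyx.prodMk_nhds hg)
  have hlhs := ((hl.mul (hlim i)).add hH').add (tendsto_finsetSum Finset.univ
    fun j _ => (((hD i j).tendsto x).comp hyx).mul (hlim j))
  refine le_of_tendsto hlhs ?_
  filter_upwards [hloc] with n hn
  exact hsub n i _ (y n) (hφ.add (contDiff_mul_norm_sq 1 x)) hn

/-- Stability of the supersolution inequalities under uniform convergence. -/
theorem SuperTest.of_tendstoUniformly {N m : ℕ} {H : Fin m → E N → E N → ℝ}
    {D : E N → Matrix (Fin m) (Fin m) ℝ} {c : Fin m → ℝ}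
    (hH : ∀ i, Continuous fun q : E N × E N => H i q.1 q.2)
    (hD : ∀ i j, Continuous fun x => D x i j) {l : ℕ → ℝ} {l₀ : ℝ}
    (hl : Tendsto l atTop (𝓝 l₀)) {v : ℕ → E N → Fin m → ℝ} {u : E N → Fin m → ℝ}
    (hv : ∀ n, Continuous (v n)) (hu : Continuous u) (hvu : TendstoUniformly v u atTop)
    (hsup : ∀ n, SuperTest H D (l n) c (v n)) : SuperTest H D l₀ c u := by
  rw [superTest_iff_subTest_neg]
  refine SubTest.of_tendstoUniformly (fun i => ?_) hD hl (v := fun n x i => -v n x i)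
    (fun n => (hv n).neg) hu.neg ?_ (fun n => superTest_iff_subTest_neg.1 (hsup n))
  · exact ((hH i).comp (continuous_fst.prodMk continuous_snd.neg)).neg
  · exact (uniformContinuous_neg (α := Fin m → ℝ)).comp_tendstoUniformly hvu

/-! ### Consequences of the subsolution inequalities -/

theorem exists_isMax_sub {N : ℕ} {g ψ : E N → ℝ} (hg : Continuous g) (hψ : Continuous ψ)
    {x : E N} {B ρ : ℝ} (hB : ∀ y, |g y| ≤ B) (hρ0 : 0 ≤ ρ)
    (hρ : ∀ y, ρ < ‖y - x‖ → ψ x + 2 * B ≤ ψ y) :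
    ∃ y, ∀ z, g z - ψ z ≤ g y - ψ y := by
  obtain ⟨y, -, hy⟩ := (isCompact_closedBall x ρ).exists_isMaxOn
    ⟨x, Metric.mem_closedBall_self hρ0⟩ (hg.sub hψ).continuousOn
  refine ⟨y, fun z => ?_⟩
  by_cases hz : z ∈ Metric.closedBall x ρ
  · exact hy hz
  · have h1 := hρ z (by simpa [dist_eq_norm] using hz)
    have h2 := hy (Metric.mem_closedBall_self hρ0)
    simp only [Set.mem_ofPred_eq, Pi.sub_apply] at h2
    linarith [(abs_le.1 (hB z)).2, (abs_le.1 (hB x)).1]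

/-- Points at which a bounded continuous function is touched from above by a smooth function are
dense. -/
theorem exists_touching_tendsto {N : ℕ} {g : E N → ℝ} (hg : Continuous g) {B : ℝ}
    (hB : ∀ y, |g y| ≤ B) (x : E N) :
    ∃ y : ℕ → E N, Tendsto y atTop (𝓝 x) ∧
      ∀ n, ∃ φ : E N → ℝ, ContDiff ℝ 1 φ ∧ IsLocalMax (fun z => g z - φ z) (y n) := by
  have hB0 : 0 ≤ B := (abs_nonneg _).trans (hB x)
  have hex : ∀ n : ℕ, ∃ y, ∀ z, g z - ((n : ℝ) + 1) * ‖z - x‖ ^ 2 ≤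
      g y - ((n : ℝ) + 1) * ‖y - x‖ ^ 2 := by
    intro n
    refine exists_isMax_sub (ρ := 1 + 2 * B) (x := x) hg
      (contDiff_mul_norm_sq _ x).continuous hB (by linarith) ?_
    intro y hy
    simp only [sub_self, norm_zero]
    have : 1 + 2 * B ≤ ‖y - x‖ ^ 2 := by nlinarith
    have hn : (0 : ℝ) ≤ n := n.cast_nonneg
    nlinarith [sq_nonneg ‖y - x‖]
  choose y hy using hex
  refine ⟨y, ?_, fun n => ⟨_, contDiff_mul_norm_sq ((n : ℝ) + 1) x,
    Eventually.of_forall (hy n)⟩⟩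
  have hsq : Tendsto (fun n => ‖y n - x‖ ^ 2) atTop (𝓝 0) := by
    refine squeeze_zero (fun n => by positivity) (fun n => ?_)
      (tendsto_const_div_atTop_nhds_zero_nat (2 * B) |>.comp (tendsto_add_atTop_nat 1))
    have := hy n x
    simp only [sub_self, norm_zero] at this
    simp only [Function.comp_apply, Nat.cast_add, Nat.cast_one]
    rw [le_div_iff₀ (by positivity)]
    linarith [(abs_le.1 (hB (y n))).2, (abs_le.1 (hB x)).1]
  rw [tendsto_iff_norm_sub_tendsto_zero]
  simpa using hsq.sqrt

/-- If the Hamiltonian is bounded below by `-f`, a bounded continuous subsolution satisfies, at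
every point, the algebraic inequality without the gradient term. -/
theorem SubTest.pointwise {N m : ℕ} {F : Fin m → E N → E N → ℝ} {f : Fin m → E N → ℝ}
    {D : E N → Matrix (Fin m) (Fin m) ℝ} {l : ℝ} {c : Fin m → ℝ} {u : E N → Fin m → ℝ}
    (hF : ∀ i x p, 0 ≤ F i x p) (hf : ∀ i, Continuous (f i))
    (hD : ∀ i j, Continuous fun x => D x i j) (hu : Continuous u) {B : ℝ}
    (hB : ∀ x i, |u x i| ≤ B) (h : SubTest (hamiltonian F f) D l c u) (x : E N) (i : Fin m) :
    l * u x i + ∑ j, D x i j * u x j ≤ f i x + c i := by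
  have huj : ∀ j, Continuous fun x => u x j := fun j => (continuous_apply j).comp hu
  obtain ⟨y, hyx, hy⟩ := exists_touching_tendsto (huj i) (fun x => hB x i) x
  have hc1 : Continuous fun x => l * u x i + ∑ j, D x i j * u x j :=
    ((huj i).const_mul l).add (continuous_finsetSum _ fun j _ => (hD i j).mul (huj j))
  refine le_of_tendsto_of_tendsto' ((hc1.tendsto x).comp hyx)
    ((((hf i).add continuous_const).tendsto x).comp hyx) fun n => ?_
  obtain ⟨φ, hφ, hmax⟩ := hy n
  have := h i φ (y n) hφ hmax
  have h0 := hF i (y n) (gradient φ (y n))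
  simp only [hamiltonian, Function.comp_apply, Pi.add_apply] at this ⊢
  linarith

/-- A bounded continuous function whose touching test functions have gradients bounded by `R` is
Lipschitz: compare with the smooth cone `(R + 1) √(ε² + |y - x|²)`, whose gradient has norm larger
than `R` except within distance `R ε` of its vertex. -/
theorem lipschitzWith_of_forall_gradient_le {N : ℕ} {g : E N → ℝ} (hg : Continuous g) {B R : ℝ}
    (hB : ∀ y, |g y| ≤ B) (hR : 0 ≤ R)
    (h : ∀ (φ : E N → ℝ) (x : E N), ContDiff ℝ 1 φ → IsLocalMax (fun y => g y - φ y) x →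
      ‖gradient φ x‖ ≤ R) :
    LipschitzWith (Real.toNNReal (R + 1)) g := by
  apply LipschitzWith.of_le_add_mul
  intro z x
  rw [Real.coe_toNNReal _ (by linarith), dist_eq_norm]
  have hB0 : 0 ≤ B := (abs_nonneg _).trans (hB x)
  set ε : ℕ → ℝ := fun n => 1 / ((n : ℝ) + 1) with hεdef
  have hε0 : ∀ n, 0 < ε n := fun n => by positivity
  have hε : Tendsto ε atTop (𝓝 0) := tendsto_one_div_add_atTop_nhds_zero_nat
  have hex : ∀ n, ∃ y, ‖y - x‖ ≤ R * ε n ∧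
      g z ≤ g y + (R + 1) * √(ε n ^ 2 + ‖z - x‖ ^ 2) := by
    intro n
    obtain ⟨y, hy⟩ := exists_isMax_sub (ρ := ε n + 2 * B) (x := x) hg
      (contDiff_mul_sqrt (R + 1) (hε0 n) x).continuous hB (by linarith [hε0 n]) (by
        intro y hy
        simp only [sub_self, norm_zero]
        have h1 : √(ε n ^ 2 + 0 ^ 2) = ε n := by
          rw [zero_pow two_ne_zero, add_zero, Real.sqrt_sq (hε0 n).le]
        have h2 : ‖y - x‖ ≤ √(ε n ^ 2 + ‖y - x‖ ^ 2) :=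
          Real.le_sqrt_of_sq_le (by nlinarith [sq_nonneg (ε n)])
        rw [h1]
        nlinarith)
    refine ⟨y, ?_, ?_⟩
    · have := h _ y (contDiff_mul_sqrt (R + 1) (hε0 n) x) (Eventually.of_forall hy)
      have hs : 0 < √(ε n ^ 2 + ‖y - x‖ ^ 2) := by
        have := hε0 n
        positivity
      rw [gradient_mul_sqrt _ (hε0 n), norm_smul, Real.norm_of_nonneg (by positivity),
        div_mul_eq_mul_div, div_le_iff₀ hs] at this
      have hsq := Real.sq_sqrt (show 0 ≤ ε n ^ 2 + ‖y - x‖ ^ 2 by positivity)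
      have h2 := pow_le_pow_left₀ (by positivity) this 2
      rw [mul_pow, mul_pow, hsq] at h2
      refine le_of_sq_le_sq ?_ (mul_nonneg hR (hε0 n).le)
      nlinarith [sq_nonneg ‖y - x‖]
    · have := hy z
      have h1 : 0 ≤ (R + 1) * √(ε n ^ 2 + ‖y - x‖ ^ 2) := by positivity
      linarith
  choose y hy1 hy2 using hex
  have hyx : Tendsto y atTop (𝓝 x) := by
    rw [tendsto_iff_norm_sub_tendsto_zero]
    refine squeeze_zero (fun n => norm_nonneg _) hy1 ?_
    simpa using hε.const_mul R
  have hlim : Tendsto (fun n => g (y n) + (R + 1) * √(ε n ^ 2 + ‖z - x‖ ^ 2)) atTop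
      (𝓝 (g x + (R + 1) * √(0 ^ 2 + ‖z - x‖ ^ 2))) :=
    ((hg.tendsto x).comp hyx).add ((((hε.pow 2).add_const _).sqrt).const_mul _)
  have := ge_of_tendsto' hlim hy2
  simpa using this

theorem exists_gradient_bound {N m : ℕ} {F : Fin m → E N → E N → ℝ} {f : Fin m → E N → ℝ}
    (hFf : IsStructured F f) {C : ℝ} (hC : 0 ≤ C) : ∃ R, ∀ i x p, F i x p ≤ C → ‖p‖ ≤ R := by
  have h := fun i => exists_uniform_coercivity_bound (hFf.continuous_F i) (hFf.periodic_F i)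
    (hFf.convex i) (hFf.coercive i) (hFf.F_zero i) hC
  choose R hR using h
  obtain ⟨R', hR'⟩ := (Set.finite_range R).bddAbove
  exact ⟨R', fun i x p hp => (hR i x p hp).trans (hR' ⟨i, rfl⟩)⟩

theorem IsStructured.continuous_hamiltonian {N m : ℕ} {F : Fin m → E N → E N → ℝ}
    {f : Fin m → E N → ℝ} (hFf : IsStructured F f) (i : Fin m) :
    Continuous fun q : E N × E N => hamiltonian F f i q.1 q.2 :=
  (hFf.continuous_F i).sub ((hFf.continuous_f i).comp continuous_fst)

/-- The Lipschitz estimate for subsolutions of the system: wherever the zeroth-order terms are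
bounded by `C`, coercivity bounds the gradients of the test functions. -/
theorem SubTest.lipschitzWith {N m : ℕ} {F : Fin m → E N → E N → ℝ} {f : Fin m → E N → ℝ}
    {D : E N → Matrix (Fin m) (Fin m) ℝ} {l : ℝ} {c : Fin m → ℝ} {u : E N → Fin m → ℝ}
    (h : SubTest (hamiltonian F f) D l c u) (hu : Continuous u) {B R C : ℝ}
    (hB : ∀ x i, |u x i| ≤ B) (hR0 : 0 ≤ R) (hR : ∀ i x p, F i x p ≤ C → ‖p‖ ≤ R)
    (hC : ∀ x i, f i x + c i - l * u x i - ∑ j, D x i j * u x j ≤ C) (i : Fin m) :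
    LipschitzWith (Real.toNNReal (R + 1)) fun x => u x i := by
  refine lipschitzWith_of_forall_gradient_le ((continuous_apply i).comp hu) (fun x => hB x i) hR0
    fun φ x hφ hmax => hR i x _ ?_
  have h1 := h i φ x hφ hmax
  simp only [hamiltonian] at h1
  linarith [hC x i]

/-! ### Comparison principle -/

theorem IsCoupling.rowSum_mul_le {N m : ℕ} {D : E N → Matrix (Fin m) (Fin m) ℝ}
    (hD : IsCoupling D) (x : E N) {a : Fin m → ℝ} {i : Fin m} (h : ∀ j, a j ≤ a i) :
    (∑ j, D x i j) * a i ≤ ∑ j, D x i j * a j := by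
  rw [Finset.sum_mul]
  refine Finset.sum_le_sum fun j _ => ?_
  by_cases hij : i = j
  · rw [hij]
  · exact mul_le_mul_of_nonpos_left (h j) (hD.offDiag_nonpos x i j hij)

/-- Maximum principle for the coupling: `(D a)_i ≥ 0` at an index where `a` is maximal and
nonnegative. -/
theorem IsCoupling.sum_mul_nonneg {N m : ℕ} {D : E N → Matrix (Fin m) (Fin m) ℝ}
    (hD : IsCoupling D) (x : E N) {a : Fin m → ℝ} {i : Fin m} (h : ∀ j, a j ≤ a i)
    (h0 : 0 ≤ a i) : 0 ≤ ∑ j, D x i j * a j :=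
  (mul_nonneg (hD.rowSum_nonneg x i) h0).trans (hD.rowSum_mul_le x h)

/-- The doubled functional attains its maximum over all pairs of points and all indices; Lipschitz
continuity of `u` bounds `a |x - y|` at a maximum. -/
theorem exists_max_doubling {N m : ℕ} [Nonempty (Fin m)] {u w : E N → Fin m → ℝ}
    (hu : Continuous u) (hw : Continuous w) (hup : ZPeriodic u) (hwp : ZPeriodic w) {L : NNReal}
    (hL : ∀ i, LipschitzWith L fun x => u x i) {a : ℝ} (ha : 1 ≤ a) :
    ∃ x y i, ‖y‖ ≤ √N ∧ a * ‖x - y‖ ≤ L ∧ ∀ x' y' i',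
      u x' i' - w y' i' - a * ‖x' - y'‖ ^ 2 ≤ u x i - w y i - a * ‖x - y‖ ^ 2 := by
  set Φ : (E N × E N) × Fin m → ℝ :=
    fun q => u q.1.1 q.2 - w q.1.2 q.2 - a * ‖q.1.1 - q.1.2‖ ^ 2 with hΦ
  have hΦc : Continuous Φ := by
    rw [continuous_prod_of_discrete_right]
    intro i
    have h1 : Continuous fun x => u x i := (continuous_apply i).comp hu
    have h2 : Continuous fun x => w x i := (continuous_apply i).comp hw
    simp only [hΦ]
    fun_prop
  set K : Set ((E N × E N) × Fin m) :=
    (Metric.closedBall 0 (√N + L) ×ˢ Metric.closedBall 0 √N) ×ˢ Set.univ with hK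
  have hKc : IsCompact K :=
    ((isCompact_closedBall _ _).prod (isCompact_closedBall _ _)).prod isCompact_univ
  have hLip : ∀ x y i, u x i - u y i ≤ L * ‖x - y‖ := fun x y i => by
    have := (hL i).dist_le_mul x y
    rw [Real.dist_eq, dist_eq_norm] at this
    exact (le_abs_self _).trans this
  obtain ⟨⟨⟨x, y⟩, i⟩, hmem, hmax⟩ := hKc.exists_isMaxOn
    ⟨((0, 0), Classical.arbitrary _), by simp [hK]; positivity⟩ hΦc.continuousOn
  have hmax' : ∀ x' y' i',
      u x' i' - w y' i' - a * ‖x' - y'‖ ^ 2 ≤ u x i - w y i - a * ‖x - y‖ ^ 2 := by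
    have hK' : ∀ x' y' i', ‖y'‖ ≤ √N → ‖x' - y'‖ ≤ L →
        u x' i' - w y' i' - a * ‖x' - y'‖ ^ 2 ≤ u x i - w y i - a * ‖x - y‖ ^ 2 := by
      intro x' y' i' hy' hxy'
      refine hmax (a := ((x', y'), i')) ⟨⟨?_, ?_⟩, Set.mem_univ _⟩
      · rw [mem_closedBall_zero_iff]
        calc ‖x'‖ = ‖y' + (x' - y')‖ := by rw [add_sub_cancel]
          _ ≤ ‖y'‖ + ‖x' - y'‖ := norm_add_le _ _
          _ ≤ √N + L := add_le_add hy' hxy'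
      · simpa using hy'
    -- Pairs at distance larger than `L` do worse than diagonal pairs.
    have hK'' : ∀ x' y' i', ‖y'‖ ≤ √N →
        u x' i' - w y' i' - a * ‖x' - y'‖ ^ 2 ≤ u x i - w y i - a * ‖x - y‖ ^ 2 := by
      intro x' y' i' hy'
      by_cases hxy' : ‖x' - y'‖ ≤ L
      · exact hK' x' y' i' hy' hxy'
      · have h1 := hK' y' y' i' hy' (by simp)
        simp only [sub_self, norm_zero] at h1
        have h2 := hLip x' y' i'
        push Not at hxy'
        have h3 : (L : ℝ) * ‖x' - y'‖ ≤ ‖x' - y'‖ ^ 2 := by nlinarith [L.coe_nonneg]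
        nlinarith [sq_nonneg ‖x' - y'‖]
    intro x' y' i'
    have h1 := hK'' (x' + WithLp.toLp 2 (fun j => ((-⌊y' j⌋ : ℤ) : ℝ))) (fractPoint y') i'
      (norm_fractPoint_le y')
    rw [hup x' _, hwp.fractPoint_eq, fractPoint, add_sub_add_right_eq_sub] at h1
    exact h1
  refine ⟨x, y, i, by simpa using hmem.1.2, ?_, hmax'⟩
  have h1 := hmax' y y i
  simp only [sub_self, norm_zero] at h1
  have h2 := hLip x y i
  rcases (norm_nonneg (x - y)).eq_or_lt with h0 | h0
  · rw [← h0, mul_zero]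
    exact L.coe_nonneg
  · refine le_of_mul_le_mul_right ?_ h0
    nlinarith

/-- Comparison principle for the discounted system, by doubling of variables; since one of the
functions is Lipschitz, the gradients `2a(x - y)` at the doubled maxima stay bounded, and no
regularity of `H` beyond continuity is needed. -/
theorem SubTest.le_of_superTest {N m : ℕ} {H : Fin m → E N → E N → ℝ}
    {D : E N → Matrix (Fin m) (Fin m) ℝ} {l : ℝ} {c : Fin m → ℝ} {u w : E N → Fin m → ℝ}
    (hH : ∀ i, Continuous fun q : E N × E N => H i q.1 q.2) (hD : IsCoupling D) (hl : 0 < l)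
    (hu : Continuous u) (hw : Continuous w) (hup : ZPeriodic u) (hwp : ZPeriodic w) {L : NNReal}
    (hL : ∀ i, LipschitzWith L fun x => u x i) (hsub : SubTest H D l c u)
    (hsup : SuperTest H D l c w) (x₀ : E N) (i₀ : Fin m) : u x₀ i₀ ≤ w x₀ i₀ := by
  by_contra! hlt
  have : Nonempty (Fin m) := ⟨i₀⟩
  have hex := fun n : ℕ => exists_max_doubling hu hw hup hwp hL (a := (n : ℝ) + 1) (by simp)
  choose x y i hy hxy hmax using hex
  set p : ℕ → E N := fun n => (2 * ((n : ℝ) + 1)) • (x n - y n) with hp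
  have hpL : ∀ n, ‖p n‖ ≤ 2 * L := by
    intro n
    rw [hp, norm_smul, Real.norm_of_nonneg (by positivity), mul_assoc]
    exact mul_le_mul_of_nonneg_left (hxy n) zero_le_two
  have hineq : ∀ n, l * u (x n) (i n) + H (i n) (x n) (p n) + ∑ j, D (x n) (i n) j * u (x n) j ≤
      l * w (y n) (i n) + H (i n) (y n) (p n) + ∑ j, D (y n) (i n) j * w (y n) j := by
    intro n
    have h1 := hsub (i n) _ (x n) (contDiff_mul_norm_sq ((n : ℝ) + 1) (y n))
      (Eventually.of_forall fun z => by
        have := hmax n z (y n) (i n)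
        simp only
        linarith)
    have h2 := hsup (i n) _ (y n) (contDiff_mul_norm_sq (-((n : ℝ) + 1)) (x n))
      (Eventually.of_forall fun z => by
        have := hmax n (x n) z (i n)
        rw [norm_sub_rev (x n) z, norm_sub_rev (x n) (y n)] at this
        simp only
        linarith)
    rw [gradient_mul_norm_sq] at h1 h2
    have h3 : (2 * -((n : ℝ) + 1)) • (y n - x n) = p n := by
      rw [hp]
      module
    rw [h3] at h2
    exact h1.trans h2
  have hge : ∀ n z j, u z j - w z j ≤ u (x n) (i n) - w (y n) (i n) := by
    intro n z j
    have := hmax n z z j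
    simp only [sub_self, norm_zero] at this
    have h2 : (0 : ℝ) ≤ ((n : ℝ) + 1) * ‖x n - y n‖ ^ 2 := by positivity
    linarith
  obtain ⟨⟨⟨y', p'⟩, i'⟩, -, s, hs, hlim⟩ :=
    (((isCompact_closedBall (0 : E N) √N).prod (isCompact_closedBall (0 : E N) (2 * L))).prod
      (isCompact_univ (X := Fin m))).tendsto_subseq (x := fun n => ((y n, p n), i n))
      fun n => ⟨⟨by simpa using hy n, by simpa using hpL n⟩, Set.mem_univ _⟩
  have hylim : Tendsto (fun n => y (s n)) atTop (𝓝 y') :=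
    (continuous_fst.comp continuous_fst).continuousAt.tendsto.comp hlim
  have hplim : Tendsto (fun n => p (s n)) atTop (𝓝 p') :=
    (continuous_snd.comp continuous_fst).continuousAt.tendsto.comp hlim
  have hilim : ∀ᶠ n in atTop, i (s n) = i' := by
    have : Tendsto (fun n => i (s n)) atTop (𝓝 i') :=
      continuous_snd.continuousAt.tendsto.comp hlim
    rwa [nhds_discrete, tendsto_pure] at this
  have hdiff : Tendsto (fun n => x n - y n) atTop (𝓝 0) := by
    rw [tendsto_zero_iff_norm_tendsto_zero]
    refine squeeze_zero (fun n => norm_nonneg _) (fun n => ?_)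
      ((tendsto_const_div_atTop_nhds_zero_nat (L : ℝ)).comp (tendsto_add_atTop_nat 1))
    simp only [Function.comp_apply, Nat.cast_add, Nat.cast_one]
    rw [le_div_iff₀ (by positivity), mul_comm]
    exact hxy n
  have hxlim : Tendsto (fun n => x (s n)) atTop (𝓝 y') := by
    simpa using (hdiff.comp hs.tendsto_atTop).add hylim
  have huj : ∀ j, Continuous fun x => u x j := fun j => (continuous_apply j).comp hu
  have hwj : ∀ j, Continuous fun x => w x j := fun j => (continuous_apply j).comp hw
  have hux := fun j => ((huj j).tendsto y').comp hxlim
  have hwy := fun j => ((hwj j).tendsto y').comp hylim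
  have hlimit : l * u y' i' + H i' y' p' + ∑ j, D y' i' j * u y' j ≤
      l * w y' i' + H i' y' p' + ∑ j, D y' i' j * w y' j := by
    refine le_of_tendsto_of_tendsto
      ((((hux i').const_mul l).add (((hH i').tendsto (y', p')).comp
        (hxlim.prodMk_nhds hplim))).add (tendsto_finsetSum Finset.univ fun j _ =>
          (((hD.continuous i' j).tendsto y').comp hxlim).mul (hux j)))
      ((((hwy i').const_mul l).add (((hH i').tendsto (y', p')).comp
        (hylim.prodMk_nhds hplim))).add (tendsto_finsetSum Finset.univ fun j _ =>
          (((hD.continuous i' j).tendsto y').comp hylim).mul (hwy j))) ?_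
    filter_upwards [hilim] with n hn
    have := hineq (s n)
    rw [hn] at this
    exact this
  have hmaxlim : ∀ z j, u z j - w z j ≤ u y' i' - w y' i' := by
    intro z j
    refine ge_of_tendsto ((hux i').sub (hwy i')) ?_
    filter_upwards [hilim] with n hn
    have := hge (s n) z j
    rw [hn] at this
    exact this
  have hpos : 0 < u y' i' - w y' i' := (sub_pos.2 hlt).trans_le (hmaxlim x₀ i₀)
  have hD0 := hD.sum_mul_nonneg y' (a := fun j => u y' j - w y' j) (i := i') (hmaxlim y') hpos.le
  simp only [mul_sub, Finset.sum_sub_distrib] at hD0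
  nlinarith [mul_pos hl hpos]

/-! ### Existence by Perron's method -/

/-- The competitors in Perron's method: continuous subsolutions with values in `[0, M]`. They are
not required to be periodic; the periodicity of their supremum follows from the invariance of this
set under integer translations. -/
def boundedSubsolutions {N m : ℕ} (F : Fin m → E N → E N → ℝ) (f : Fin m → E N → ℝ)
    (D : E N → Matrix (Fin m) (Fin m) ℝ) (l M : ℝ) : Set (E N → Fin m → ℝ) :=
  {v | Continuous v ∧ (∀ x i, 0 ≤ v x i ∧ v x i ≤ M) ∧ SubTest (hamiltonian F f) D l 0 v}

/-- The pointwise supremum of the bounded subsolutions. -/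
noncomputable def perronSup {N m : ℕ} (F : Fin m → E N → E N → ℝ) (f : Fin m → E N → ℝ)
    (D : E N → Matrix (Fin m) (Fin m) ℝ) (l M : ℝ) (x : E N) (i : Fin m) : ℝ :=
  ⨆ v : boundedSubsolutions F f D l M, v.1 x i

/-- Since the off-diagonal entries are nonpositive, increasing the other components lowers the
coupling term. -/
theorem IsCoupling.sum_mul_add_le {N m : ℕ} {D : E N → Matrix (Fin m) (Fin m) ℝ}
    (hD : IsCoupling D) (x : E N) {a b : Fin m → ℝ} {i : Fin m} (h : ∀ j, j ≠ i → a j ≤ b j) :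
    ∑ j, D x i j * b j + D x i i * (a i - b i) ≤ ∑ j, D x i j * a j := by
  have h1 : ∑ j, D x i j * b j + D x i i * (a i - b i) =
      ∑ j, (D x i j * b j + if j = i then D x i i * (a i - b i) else 0) := by
    rw [Finset.sum_add_distrib]
    simp
  rw [h1]
  refine Finset.sum_le_sum fun j _ => ?_
  by_cases hj : j = i
  · subst hj
    simp only [if_true]
    linarith
  · simp only [hj, if_false, add_zero]
    exact mul_le_mul_of_nonpos_left (h j hj) (hD.offDiag_nonpos x i j (Ne.symm hj))

theorem zero_mem_boundedSubsolutions {N m : ℕ} {F : Fin m → E N → E N → ℝ}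
    {f : Fin m → E N → ℝ} {D : E N → Matrix (Fin m) (Fin m) ℝ} (hFf : IsStructured F f) {l M : ℝ}
    (hM : 0 ≤ M) : (fun _ _ => 0) ∈ boundedSubsolutions F f D l M := by
  refine ⟨continuous_const, fun _ _ => ⟨le_rfl, hM⟩, fun i φ x hφ hmax => ?_⟩
  have := gradient_eq_of_isLocalMax_sub contDiff_const hφ hmax
  rw [gradient_fun_const] at this
  simp only [hamiltonian, ← this, hFf.F_zero, mul_zero, Finset.sum_const_zero, Pi.zero_apply]
  linarith [hFf.f_nonneg i x]

theorem le_perronSup {N m : ℕ} {F : Fin m → E N → E N → ℝ} {f : Fin m → E N → ℝ}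
    {D : E N → Matrix (Fin m) (Fin m) ℝ} {l M : ℝ} {v : E N → Fin m → ℝ}
    (hv : v ∈ boundedSubsolutions F f D l M) (x : E N) (i : Fin m) :
    v x i ≤ perronSup F f D l M x i :=
  le_ciSup (f := fun v : boundedSubsolutions F f D l M => v.1 x i)
    ⟨M, by rintro _ ⟨w, rfl⟩; exact (w.2.2.1 x i).2⟩ ⟨v, hv⟩

theorem exists_lipschitzWith_boundedSubsolutions {N m : ℕ} {F : Fin m → E N → E N → ℝ}
    {f : Fin m → E N → ℝ} {D : E N → Matrix (Fin m) (Fin m) ℝ} (hD : IsCoupling D)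
    (hFf : IsStructured F f) {l M : ℝ} (hl : 0 < l) (hM : 0 ≤ M) :
    ∃ K, ∀ v ∈ boundedSubsolutions F f D l M, ∀ i, LipschitzWith K fun x => v x i := by
  obtain ⟨Bf, hBf0, hBf⟩ := ZPeriodic.exists_bound hFf.continuous_f hFf.periodic_f
  obtain ⟨Bd, hBd0, hBd⟩ := ZPeriodic.exists_bound (g := fun (q : Fin m × Fin m) x => D x q.1 q.2)
    (fun q => hD.continuous q.1 q.2) (fun q => hD.periodic q.1 q.2)
  obtain ⟨R, hR⟩ := exists_gradient_bound hFf (C := Bf + m * (Bd * M)) (by positivity)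
  refine ⟨Real.toNNReal (max R 0 + 1), fun v hv i => ?_⟩
  refine hv.2.2.lipschitzWith hv.1 (B := M)
    (fun x i => abs_le.2 ⟨by linarith [(hv.2.1 x i).1], (hv.2.1 x i).2⟩) (le_max_right _ _)
    (fun i x p hp => (hR i x p hp).trans (le_max_left _ _)) (fun x i => ?_) i
  have h1 : ∑ j, -(D x i j * v x j) ≤ ∑ _j : Fin m, Bd * M := by
    refine Finset.sum_le_sum fun j _ => ?_
    have h2 : |D x i j * v x j| ≤ Bd * M := by
      rw [abs_mul, abs_of_nonneg (hv.2.1 x j).1]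
      exact mul_le_mul (hBd (i, j) x) (hv.2.1 x j).2 (hv.2.1 x j).1 hBd0
    exact (neg_le_abs _).trans h2
  simp only [Finset.sum_neg_distrib, Finset.sum_const, Finset.card_univ, Fintype.card_fin,
    nsmul_eq_mul] at h1
  have h3 := mul_nonneg hl.le (hv.2.1 x i).1
  simp only [Pi.zero_apply]
  linarith [(abs_le.1 (hBf i x)).2]

/-- The supremum of the bounded subsolutions is a bounded subsolution. -/
theorem perronSup_mem_boundedSubsolutions {N m : ℕ} {F : Fin m → E N → E N → ℝ}
    {f : Fin m → E N → ℝ} {D : E N → Matrix (Fin m) (Fin m) ℝ} (hD : IsCoupling D)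
    (hFf : IsStructured F f) {l M : ℝ} (hl : 0 < l) (hM : 0 ≤ M) :
    perronSup F f D l M ∈ boundedSubsolutions F f D l M := by
  obtain ⟨K, hK⟩ := exists_lipschitzWith_boundedSubsolutions hD hFf hl hM
  have hne : Nonempty (boundedSubsolutions F f D l M) :=
    ⟨⟨_, zero_mem_boundedSubsolutions hFf hM⟩⟩
  have hLip : ∀ i, LipschitzWith K fun x => perronSup F f D l M x i := by
    intro i
    refine LipschitzWith.of_le_add_mul K fun x y => ciSup_le fun v => ?_
    have h1 := (hK v.1 v.2 i).dist_le_mul x y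
    rw [Real.dist_eq] at h1
    linarith [le_perronSup v.2 y i, le_abs_self (v.1 x i - v.1 y i)]
  have hcont : Continuous (perronSup F f D l M) := continuous_pi fun i => (hLip i).continuous
  refine ⟨hcont, fun x i => ⟨le_perronSup (zero_mem_boundedSubsolutions hFf hM) x i,
    ciSup_le fun v => (v.2.2.1 x i).2⟩, ?_⟩
  intro i φ x hφ hmax
  set u := perronSup F f D l M with hu
  have hex : ∀ n : ℕ, ∃ v ∈ boundedSubsolutions F f D l M,
      u x i - 1 / ((n : ℝ) + 1) < v x i := by
    intro n
    have h1 : u x i - 1 / ((n : ℝ) + 1) < u x i :=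
      sub_lt_self _ (by positivity)
    obtain ⟨v, hv⟩ := exists_lt_of_lt_ciSup
      (f := fun v : boundedSubsolutions F f D l M => v.1 x i) h1
    exact ⟨v.1, v.2, hv⟩
  choose v hvS hvx using hex
  have hvu : ∀ n y j, v n y j ≤ u y j := fun n y j => le_perronSup (hvS n) y j
  obtain ⟨y, hyx, hvy, hloc⟩ := exists_isLocalMax_tendsto hφ.continuous hmax
    (v := fun n x => v n x i) (fun n => (continuous_apply i).comp (hvS n).1)
    (fun ε hε => Eventually.of_forall fun n y => by linarith [hvu n y i])
    (tendsto_of_tendsto_of_tendsto_of_le_of_le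
      (by simpa using (tendsto_one_div_add_atTop_nhds_zero_nat (𝕜 := ℝ)).const_sub (u x i))
      tendsto_const_nhds (fun n => (hvx n).le) (fun n => hvu n x i))
  have huy : ∀ j, Tendsto (fun n => u (y n) j) atTop (𝓝 (u x j)) := fun j =>
    (((continuous_apply j).comp hcont).tendsto x).comp hyx
  have hDy : ∀ j, Tendsto (fun n => D (y n) i j) atTop (𝓝 (D x i j)) := fun j =>
    ((hD.continuous i j).tendsto x).comp hyx
  have hg := tendsto_gradient_add_mul_norm_sq hφ hyx 1
  have hH' := ((hFf.continuous_hamiltonian i).tendsto (x, gradient φ x)).comp (hyx.prodMk_nhds hg)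
  have hlim := ((hvy.const_mul l).add hH').add ((tendsto_finsetSum Finset.univ
    fun j _ => (hDy j).mul (huy j)).add ((hDy i).mul (hvy.sub (huy i))))
  simp only [sub_self, mul_zero, add_zero] at hlim
  refine le_of_tendsto hlim ?_
  filter_upwards [hloc] with n hn
  have h1 := (hvS n).2.2 i _ (y n) (hφ.add (contDiff_mul_norm_sq 1 x)) hn
  have h2 := hD.sum_mul_add_le (y n) (a := v n (y n)) (b := u (y n)) (i := i)
    fun j _ => hvu n (y n) j
  simp only [Function.comp_apply] at h1 h2 ⊢
  linarith

/-- The bump construction: a bounded subsolution violating a supersolution inequality at `x₀` can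
be raised there within the class of bounded subsolutions. The upper barrier `M` is a constant
supersolution, so that a violation can only occur strictly below it. -/
theorem exists_bump {N m : ℕ} {F : Fin m → E N → E N → ℝ} {f : Fin m → E N → ℝ}
    {D : E N → Matrix (Fin m) (Fin m) ℝ} (hD : IsCoupling D) (hFf : IsStructured F f) {l M : ℝ}
    (hM : 0 ≤ M) (hfM : ∀ i x, f i x ≤ l * M) {u : E N → Fin m → ℝ}
    (hu : u ∈ boundedSubsolutions F f D l M) {i₀ : Fin m} {φ : E N → ℝ} {x₀ : E N}
    (hφ : ContDiff ℝ 1 φ) (hmin : IsLocalMin (fun y => u y i₀ - φ y) x₀)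
    (hlt : l * u x₀ i₀ + hamiltonian F f i₀ x₀ (gradient φ x₀) +
      ∑ j, D x₀ i₀ j * u x₀ j < 0) :
    ∃ v ∈ boundedSubsolutions F f D l M, u x₀ i₀ < v x₀ i₀ := by
  obtain ⟨huc, hu0, husub⟩ := hu
  have huj : ∀ j, Continuous fun x => u x j := fun j => (continuous_apply j).comp huc
  have hltM : u x₀ i₀ < M := by
    refine lt_of_le_of_ne (hu0 x₀ i₀).2 fun hEq => ?_
    have hφmax : IsLocalMax (fun y => φ y - (fun _ => (0 : ℝ)) y) x₀ := by
      filter_upwards [hmin] with y hy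
      have := (hu0 y i₀).2
      linarith
    have hg := gradient_eq_of_isLocalMax_sub hφ contDiff_const hφmax
    rw [gradient_fun_const] at hg
    have h1 := hD.sum_mul_nonneg x₀ (a := u x₀) (i := i₀)
      (fun j => by rw [hEq]; exact (hu0 x₀ j).2) (by rw [hEq]; exact hM)
    rw [hg, hEq] at hlt
    simp only [hamiltonian, hFf.F_zero] at hlt
    linarith [hfM i₀ x₀]
  set ψ : ℝ → E N → ℝ := fun δ z => (φ z + (-1) * ‖z - x₀‖ ^ 2) + (u x₀ i₀ - φ x₀ + δ) with hψ
  have hψd : ∀ δ, ContDiff ℝ 1 (ψ δ) := fun δ =>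
    (hφ.add (contDiff_mul_norm_sq (-1) x₀)).add contDiff_const
  have hψg : ∀ δ z, gradient (ψ δ) z = gradient φ z + (2 * (-1 : ℝ)) • (z - x₀) := fun δ z => by
    rw [hψ, gradient_add_of_contDiff (hφ.add (contDiff_mul_norm_sq (-1) x₀)) contDiff_const,
      gradient_fun_const, add_zero, gradient_add_mul_norm_sq hφ]
  set G : E N × ℝ → ℝ := fun q => l * ψ q.2 q.1 + hamiltonian F f i₀ q.1
    (gradient φ q.1 + (2 * (-1 : ℝ)) • (q.1 - x₀)) + (∑ j, D q.1 i₀ j * u q.1 j +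
      D q.1 i₀ i₀ * (ψ q.2 q.1 - u q.1 i₀)) with hG
  have hψc : Continuous fun q : E N × ℝ => ψ q.2 q.1 := by
    have := hφ.continuous
    simp only [hψ]
    fun_prop
  have hGc : Continuous G := by
    have h1 := (hFf.continuous_hamiltonian i₀).comp ((continuous_fst (X := E N) (Y := ℝ)).prodMk
      (((continuous_gradient hφ).comp continuous_fst).add
        ((continuous_fst.sub (continuous_const (y := x₀))).const_smul (2 * (-1 : ℝ)))))
    have h2 : ∀ j, Continuous fun q : E N × ℝ => D q.1 i₀ j := fun j =>
      (hD.continuous i₀ j).comp continuous_fst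
    have h3 : ∀ j, Continuous fun q : E N × ℝ => u q.1 j := fun j => (huj j).comp continuous_fst
    exact ((hψc.const_mul l).add h1).add ((continuous_finsetSum _ fun j _ =>
      (h2 j).mul (h3 j)).add ((h2 i₀).mul (hψc.sub (h3 i₀))))
  have hψ0 : ψ 0 x₀ = u x₀ i₀ := by simp [hψ]
  have hG0 : G (x₀, 0) < 0 := by
    simp only [hG, hψ0, sub_self, smul_zero, add_zero, mul_zero]
    exact hlt
  have hev : ∀ᶠ q in 𝓝 (x₀, (0 : ℝ)), G q < 0 ∧ ψ q.2 q.1 < M ∧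
      u x₀ i₀ - φ x₀ ≤ u q.1 i₀ - φ q.1 :=
    ((hGc.tendsto _).eventually_lt_const hG0).and
      (((hψc.tendsto (x₀, (0 : ℝ))).eventually_lt_const (by rw [hψ0]; exact hltM)).and
        ((continuous_fst.tendsto (x₀, (0 : ℝ))).eventually hmin))
  obtain ⟨r, hr, hball⟩ := Metric.eventually_nhds_iff.1 hev
  -- The bump lives on the ball of radius `r / 2`; its height is at most the loss `(r / 2) ^ 2`
  -- of the strict test function on the boundary.
  set δ : ℝ := min (r / 2) ((r / 2) ^ 2) with hδ
  have hδ0 : 0 < δ := lt_min (by positivity) (by positivity)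
  have hδr : δ < r := (min_le_left _ _).trans_lt (by linarith)
  have hin : ∀ z, ‖z - x₀‖ ≤ r / 2 → G (z, δ) < 0 ∧ ψ δ z < M ∧
      u x₀ i₀ - φ x₀ ≤ u z i₀ - φ z := by
    intro z hz
    refine hball (y := (z, δ)) ?_
    rw [Prod.dist_eq, max_lt_iff, dist_eq_norm, Real.dist_eq, sub_zero, abs_of_pos hδ0]
    exact ⟨by linarith, hδr⟩
  set g : E N → ℝ := fun z => if ‖z - x₀‖ < r / 2 then max (u z i₀) (ψ δ z) else u z i₀ with hg
  have hgc : Continuous g := by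
    refine Continuous.if (fun z hz => ?_) ((huj i₀).max (hψd δ).continuous) (huj i₀)
    have hz' : ‖z - x₀‖ = r / 2 := by
      have h1 : {z : E N | ‖z - x₀‖ < r / 2} = Metric.ball x₀ (r / 2) := by
        ext z
        simp [dist_eq_norm]
      rw [h1] at hz
      simpa [dist_eq_norm] using Metric.frontier_ball_subset_sphere hz
    have h2 := (hin z hz'.le).2.2
    have h3 : δ ≤ (r / 2) ^ 2 := min_le_right _ _
    refine max_eq_left ?_
    simp only [hψ, hz']
    linarith
  have hug : ∀ z, u z i₀ ≤ g z := by
    intro z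
    simp only [hg]
    split_ifs
    · exact le_max_left _ _
    · exact le_rfl
  have hgM : ∀ z, g z ≤ M := by
    intro z
    simp only [hg]
    split_ifs with h
    · exact max_le (hu0 z i₀).2 (hin z h.le).2.1.le
    · exact (hu0 z i₀).2
  have hcases : ∀ z, g z = u z i₀ ∨ (‖z - x₀‖ < r / 2 ∧ g z = ψ δ z) := by
    intro z
    simp only [hg]
    split_ifs with h
    · rcases max_choice (u z i₀) (ψ δ z) with h' | h'
      · exact Or.inl h'
      · exact Or.inr ⟨h, h'⟩
    · exact Or.inl rfl
  have hψg' : ∀ z, ‖z - x₀‖ < r / 2 → ψ δ z ≤ g z := by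
    intro z hz
    simp only [hg, hz, if_true]
    exact le_max_right _ _
  have huv : ∀ y j, u y j ≤ Function.update (u y) i₀ (g y) j := by
    intro y j
    by_cases hj : j = i₀
    · subst hj
      simpa using hug y
    · simp [hj]
  refine ⟨fun z => Function.update (u z) i₀ (g z), ⟨huc.update i₀ hgc, fun z i => ?_, ?_⟩, ?_⟩
  · refine ⟨(hu0 z i).1.trans (huv z i), ?_⟩
    by_cases hi : i = i₀
    · subst hi
      simpa using hgM z
    · simpa [hi] using (hu0 z i).2
  · intro i χ y hχ hmax
    by_cases hi : i = i₀
    · subst hi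
      simp only [Function.update_self] at hmax ⊢
      rcases hcases y with hy | ⟨hyr, hy⟩
      · have hmax' : IsLocalMax (fun z => u z i - χ z) y := by
          filter_upwards [hmax] with z hz
          have := hug z
          simp only [hy] at hz ⊢
          linarith
        have := husub i χ y hχ hmax'
        rw [hy, Function.update_eq_self]
        exact this
      · have hmax' : IsLocalMax (fun z => ψ δ z - χ z) y := by
          have hopen : IsOpen {z : E N | ‖z - x₀‖ < r / 2} :=
            isOpen_lt (by fun_prop) continuous_const
          filter_upwards [hmax, hopen.mem_nhds hyr] with z hz hzr
          have := hψg' z hzr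
          simp only [hy] at hz ⊢
          linarith
        have hgr := gradient_eq_of_isLocalMax_sub (hψd δ) hχ hmax'
        rw [hψg] at hgr
        have h1 := (hin y hyr.le).1
        have h2 := hD.sum_mul_add_le y (a := u y) (b := Function.update (u y) i (g y)) (i := i)
          fun j _ => huv y j
        simp only [hG, hgr] at h1
        simp only [Function.update_self, hy] at h2 ⊢
        simp only [Pi.zero_apply]
        linarith
    · simp only [Function.update_of_ne hi] at hmax ⊢
      have h1 := husub i χ y hχ hmax
      have h2 := hD.sum_mul_add_le y (a := u y) (b := Function.update (u y) i₀ (g y)) (i := i)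
          fun j _ => huv y j
      simp only [Function.update_of_ne hi, sub_self, mul_zero, add_zero] at h2
      linarith
  · simp only [Function.update_self]
    refine lt_of_lt_of_le ?_ (hψg' x₀ (by simpa using hr))
    simp only [hψ, sub_self, norm_zero]
    linarith

theorem translate_isLocalMax {N : ℕ} {g : E N → ℝ} {x k : E N}
    (h : IsLocalMax (fun y => g (y + k)) x) : IsLocalMax g (x + k) := by
  have h1 : Tendsto (fun z : E N => z - k) (𝓝 (x + k)) (𝓝 x) := by
    have : Continuous fun z : E N => z - k := by fun_prop
    simpa using this.tendsto (x + k)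
  filter_upwards [h1.eventually h] with z hz
  simpa using hz

theorem gradient_comp_sub {N : ℕ} (φ : E N → ℝ) (k x : E N) :
    gradient (fun y => φ (y - k)) x = gradient φ (x - k) := by
  unfold gradient
  rw [fderiv_comp_sub]

/-- Integer translations preserve the set of bounded subsolutions. -/
theorem translate_mem_boundedSubsolutions {N m : ℕ} {F : Fin m → E N → E N → ℝ}
    {f : Fin m → E N → ℝ} {D : E N → Matrix (Fin m) (Fin m) ℝ} (hD : IsCoupling D)
    (hFf : IsStructured F f) {l M : ℝ} {v : E N → Fin m → ℝ}
    (hv : v ∈ boundedSubsolutions F f D l M) (k : Fin N → ℤ) :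
    (fun x => v (x + WithLp.toLp 2 (fun j => (k j : ℝ)))) ∈ boundedSubsolutions F f D l M := by
  set κ : E N := WithLp.toLp 2 (fun j => (k j : ℝ)) with hκ
  refine ⟨hv.1.comp (continuous_id.add continuous_const), fun x i => hv.2.1 _ i, ?_⟩
  intro i φ x hφ hmax
  have h1 := hv.2.2 i (fun y => φ (y - κ)) (x + κ) (hφ.comp (contDiff_id.sub contDiff_const))
    (translate_isLocalMax (by simpa using hmax))
  rw [gradient_comp_sub, add_sub_cancel_right] at h1
  simp only [hamiltonian] at h1 ⊢
  have hF := hFf.periodic_F i (gradient φ x) x k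
  have hf := hFf.periodic_f i x k
  have hDk := fun j => hD.periodic i j x k
  simp only [← hκ] at hF hf hDk
  rw [hF, hf] at h1
  simp only [hDk] at h1
  exact h1

theorem zPeriodic_perronSup {N m : ℕ} {F : Fin m → E N → E N → ℝ}
    {f : Fin m → E N → ℝ} {D : E N → Matrix (Fin m) (Fin m) ℝ} (hD : IsCoupling D)
    (hFf : IsStructured F f) {l M : ℝ} (hM : 0 ≤ M) : ZPeriodic (perronSup F f D l M) := by
  have hne : Nonempty (boundedSubsolutions F f D l M) :=
    ⟨⟨_, zero_mem_boundedSubsolutions hFf hM⟩⟩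
  have hle : ∀ x (k : Fin N → ℤ) i, perronSup F f D l M
      (x + WithLp.toLp 2 (fun j => (k j : ℝ))) i ≤ perronSup F f D l M x i := by
    intro x k i
    refine ciSup_le fun v => ?_
    exact le_perronSup (translate_mem_boundedSubsolutions hD hFf v.2 k) x i
  intro x k
  funext i
  refine le_antisymm (hle x k i) ?_
  have := hle (x + WithLp.toLp 2 (fun j => (k j : ℝ))) (fun j => -k j) i
  have h0 : x + WithLp.toLp 2 (fun j => (k j : ℝ)) + WithLp.toLp 2 (fun j => ((-k j : ℤ) : ℝ)) =
      x := by
    ext j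
    simp
  rwa [h0] at this

theorem IsSolution.of_tests {N m : ℕ} {H : Fin m → E N → E N → ℝ}
    {D : E N → Matrix (Fin m) (Fin m) ℝ} {l : ℝ} {c : Fin m → ℝ} {u : E N → Fin m → ℝ}
    (hu : Continuous u) (hp : ZPeriodic u) (hsub : SubTest H D l c u)
    (hsup : SuperTest H D l c u) : IsSolution H D l c u :=
  ⟨hu, ⟨fun i => ((continuous_apply i).comp hu).upperSemicontinuous, hp, hsub⟩,
    ⟨fun i => ((continuous_apply i).comp hu).lowerSemicontinuous, hp, hsup⟩⟩

/-- The discounted system has a nonnegative solution. -/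
theorem exists_isDiscountedSolution {N m : ℕ} {F : Fin m → E N → E N → ℝ}
    {f : Fin m → E N → ℝ} {D : E N → Matrix (Fin m) (Fin m) ℝ} (hD : IsCoupling D)
    (hFf : IsStructured F f) {l : ℝ} (hl : 0 < l) :
    ∃ u, IsDiscountedSolution (hamiltonian F f) D l u ∧ ∀ x i, 0 ≤ u x i := by
  obtain ⟨Bf, hBf0, hBf⟩ := ZPeriodic.exists_bound hFf.continuous_f hFf.periodic_f
  have hM : 0 ≤ Bf / l := by positivity
  have hfM : ∀ i x, f i x ≤ l * (Bf / l) := fun i x => by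
    rw [mul_div_cancel₀ _ hl.ne']
    exact (abs_le.1 (hBf i x)).2
  have hmem := perronSup_mem_boundedSubsolutions hD hFf hl hM
  refine ⟨perronSup F f D l (Bf / l), IsSolution.of_tests hmem.1
    (zPeriodic_perronSup hD hFf hM) hmem.2.2 ?_, fun x i => (hmem.2.1 x i).1⟩
  intro i φ x hφ hmin
  by_contra! hlt
  obtain ⟨v, hv, hlt'⟩ := exists_bump hD hFf hM hfM hmem hφ hmin hlt
  exact hlt'.not_ge (le_perronSup hv x i)

/-- Continuous solutions of the discounted system are unique: they are Lipschitz, so that the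
comparison principle applies to them in both directions. -/
theorem IsDiscountedSolution.unique {N m : ℕ} {F : Fin m → E N → E N → ℝ}
    {f : Fin m → E N → ℝ} {D : E N → Matrix (Fin m) (Fin m) ℝ} (hD : IsCoupling D)
    (hFf : IsStructured F f) {l : ℝ} (hl : 0 < l) {u w : E N → Fin m → ℝ}
    (hu : IsDiscountedSolution (hamiltonian F f) D l u)
    (hw : IsDiscountedSolution (hamiltonian F f) D l w) : u = w := by
  have hLip : ∀ {v}, IsDiscountedSolution (hamiltonian F f) D l v →
      ∃ K, ∀ i, LipschitzWith K fun x => v x i := by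
    intro v hv
    have hvj : ∀ j, Continuous fun x => v x j := fun j => (continuous_apply j).comp hv.continuous
    obtain ⟨B, hB0, hB⟩ := ZPeriodic.exists_bound (g := fun i x => v x i) hvj
      (fun i => hv.sub.periodic.apply i)
    obtain ⟨C, hC0, hC⟩ := ZPeriodic.exists_bound
      (g := fun i x => f i x + 0 - l * v x i - ∑ j, D x i j * v x j)
      (fun i => (((hFf.continuous_f i).add continuous_const).sub ((hvj i).const_mul l)).sub
        (continuous_finsetSum _ fun j _ => (hD.continuous i j).mul (hvj j)))
      (fun i x k => by
        have h1 := hFf.periodic_f i x k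
        have h2 := hv.sub.periodic x k
        have h3 := fun j => hD.periodic i j x k
        simp only at h1 h2 h3 ⊢
        simp only [h1, h2, h3])
    obtain ⟨R, hR⟩ := exists_gradient_bound hFf hC0
    exact ⟨_, SubTest.lipschitzWith hv.sub.test hv.continuous (fun x i => hB i x) (le_max_right R 0)
      (fun i x p hp => (hR i x p hp).trans (le_max_left _ _))
      (fun x i => (abs_le.1 (hC i x)).2)⟩
  obtain ⟨K, hK⟩ := hLip hu
  obtain ⟨K', hK'⟩ := hLip hw
  funext x i
  exact le_antisymm
    (SubTest.le_of_superTest hFf.continuous_hamiltonian hD hl hu.continuous hw.continuous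
      hu.sub.periodic hw.sub.periodic hK hu.sub.test hw.super.test x i)
    (SubTest.le_of_superTest hFf.continuous_hamiltonian hD hl hw.continuous hu.continuous
      hw.sub.periodic hu.sub.periodic hK' hw.sub.test hu.super.test x i)

/-! ### Irreducibility -/

/-- Strict form of the maximum principle for the coupling at a maximal index of `a` that is linked
to a nonmaximal one. -/
theorem IsCoupling.rowSum_mul_lt {N m : ℕ} {D : E N → Matrix (Fin m) (Fin m) ℝ}
    (hD : IsCoupling D) (x : E N) {a : Fin m → ℝ} {i j : Fin m} (h : ∀ j, a j ≤ a i)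
    (hij : D x i j ≠ 0) (hj : a j ≠ a i) :
    (∑ j, D x i j) * a i < ∑ j, D x i j * a j := by
  have hne : i ≠ j := fun h' => hj (by rw [h'])
  rw [Finset.sum_mul]
  refine Finset.sum_lt_sum (fun k _ => ?_) ⟨j, Finset.mem_univ _, ?_⟩
  · by_cases hik : i = k
    · rw [hik]
    · exact mul_le_mul_of_nonpos_left (h k) (hD.offDiag_nonpos x i k hik)
  · exact mul_lt_mul_of_neg_left ((h j).lt_of_ne hj)
      ((hD.offDiag_nonpos x i j hne).lt_of_ne hij)

/-- Under irreducibility, a nonconstant vector with a nonnegative maximum has `(D a)_i > 0` at some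
index. -/
theorem IsCoupling.exists_sum_mul_pos {N m : ℕ} {D : E N → Matrix (Fin m) (Fin m) ℝ}
    (hD : IsCoupling D) {x : E N} (hirr : IsIrreducibleMatrix (D x)) {a : Fin m → ℝ}
    {i₀ j₀ : Fin m} (h : ∀ j, a j ≤ a i₀) (h0 : 0 ≤ a i₀) (hj₀ : a j₀ ≠ a i₀) :
    ∃ i, 0 < ∑ j, D x i j * a j := by
  obtain ⟨i, hi, j, hj, hij⟩ := hirr {i | a i = a i₀} ⟨i₀, rfl⟩
    (fun hu => hj₀ (by have := Set.mem_univ j₀; rwa [← hu] at this))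
  have hi' : a i = a i₀ := hi
  have hj' : a j ≠ a i₀ := hj
  refine ⟨i, lt_of_le_of_lt ?_ (hD.rowSum_mul_lt x (i := i) (fun k => by rw [hi']; exact h k) hij
    (by rwa [hi']))⟩
  exact mul_nonneg (hD.rowSum_nonneg x i) (by rwa [hi'])

/-- Quantitative form of irreducibility: for nonnegative `a`, an upper bound on `D(x) a` controls
the oscillation of `a` among the indices, uniformly in `x`. After normalization to minimum `0` and
maximum `1`, this is compactness. -/
theorem IsCoupling.exists_osc_bound {N m : ℕ} {D : E N → Matrix (Fin m) (Fin m) ℝ}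
    (hD : IsCoupling D) (hirr : ∀ x, IsIrreducibleMatrix (D x)) :
    ∃ C, 0 ≤ C ∧ ∀ x (a : Fin m → ℝ) (B : ℝ), (∀ j, 0 ≤ a j) → 0 ≤ B →
      (∀ i, ∑ j, D x i j * a j ≤ B) → ∀ i j, a i - a j ≤ C * B := by
  set K : Set (E N × (Fin m → ℝ)) := (Metric.closedBall 0 √N ×ˢ Set.Icc 0 1) ∩
    ((⋃ i, {q | q.2 i = 0}) ∩ ⋃ i, {q | q.2 i = 1}) with hK
  have hKc : IsCompact K := by
    refine ((isCompact_closedBall _ _).prod isCompact_Icc).inter_right (IsClosed.inter ?_ ?_) <;>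
    exact isClosed_iUnion_of_finite fun i => isClosed_eq (by fun_prop) continuous_const
  set S : E N × (Fin m → ℝ) → ℝ := fun q => ∑ i, max 0 (∑ j, D q.1 i j * q.2 j) with hS
  have hSc : Continuous S := by
    refine continuous_finsetSum _ fun i _ => continuous_const.max
      (continuous_finsetSum _ fun j _ => ?_)
    exact ((hD.continuous i j).comp continuous_fst).mul
      ((continuous_apply j).comp continuous_snd)
  have hSpos : ∀ q ∈ K, 0 < S q := by
    rintro ⟨x, w⟩ ⟨⟨-, hw⟩, hw0, hw1⟩
    obtain ⟨j₀, hj₀⟩ := Set.mem_iUnion.1 hw0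
    obtain ⟨i₀, hi₀⟩ := Set.mem_iUnion.1 hw1
    have hj₀' : w j₀ = 0 := hj₀
    have hi₀' : w i₀ = 1 := hi₀
    obtain ⟨i, hi⟩ := hD.exists_sum_mul_pos (hirr x) (a := w) (i₀ := i₀) (j₀ := j₀)
      (fun j => by rw [hi₀']; exact hw.2 j) (by rw [hi₀']; exact zero_le_one)
      (by rw [hi₀', hj₀']; exact zero_ne_one)
    exact Finset.sum_pos' (fun _ _ => le_max_left _ _)
      ⟨i, Finset.mem_univ _, lt_max_of_lt_right hi⟩
  obtain ⟨η, hη, hηS⟩ := hKc.exists_forall_le' hSc.continuousOn hSpos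
  refine ⟨m / η, by positivity, fun x a B ha hB hDa i j => ?_⟩
  have : Nonempty (Fin m) := ⟨i⟩
  obtain ⟨i₁, hi₁⟩ := Finite.exists_max a
  obtain ⟨j₁, hj₁⟩ := Finite.exists_min a
  refine le_trans (sub_le_sub (hi₁ i) (hj₁ j)) ?_
  rcases (sub_nonneg.2 (hj₁ i₁)).eq_or_lt with h0 | hosc
  · rw [← h0]
    positivity
  set ω := a i₁ - a j₁ with hω
  have hmem : (fractPoint x, fun k => (a k - a j₁) / ω) ∈ K := by
    refine ⟨⟨fractPoint_mem x, fun k => ?_, fun k => ?_⟩, Set.mem_iUnion.2 ⟨j₁, ?_⟩,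
      Set.mem_iUnion.2 ⟨i₁, ?_⟩⟩
    · exact div_nonneg (sub_nonneg.2 (hj₁ k)) hosc.le
    · exact (div_le_one hosc).2 (sub_le_sub_right (hi₁ k) _)
    · simp
    · exact div_self hosc.ne'
  have hrow : ∀ k, max 0 (∑ j, D (fractPoint x) k j * ((a j - a j₁) / ω)) ≤ B / ω := by
    intro k
    refine max_le (by positivity) ?_
    have h1 : ∑ j, D (fractPoint x) k j * ((a j - a j₁) / ω) =
        (∑ j, D x k j * a j - (∑ j, D x k j) * a j₁) / ω := by
      rw [Finset.sum_mul, ← Finset.sum_sub_distrib, Finset.sum_div]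
      refine Finset.sum_congr rfl fun j _ => ?_
      rw [(hD.periodic k j).fractPoint_eq x]
      ring
    rw [h1]
    refine div_le_div_of_nonneg_right ?_ hosc.le
    linarith [hDa k, mul_nonneg (hD.rowSum_nonneg x k) (ha j₁)]
  have h2 : η ≤ m * (B / ω) := by
    refine (hηS _ hmem).trans ((Finset.sum_le_sum fun k _ => hrow k).trans ?_)
    simp
  rw [div_mul_eq_mul_div, le_div_iff₀ hη]
  rw [← mul_div_assoc, le_div_iff₀ hosc] at h2
  linarith

/-! ### Uniform estimates and the vanishing discount limit -/

theorem f_eq_zero_of_mem_zeroSet {N m : ℕ} {F : Fin m → E N → E N → ℝ} {f : Fin m → E N → ℝ}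
    (hFf : IsStructured F f) {x : E N} (hx : x ∈ zeroSet f) (i : Fin m) : f i x = 0 :=
  (Finset.sum_eq_zero_iff_of_nonneg fun i _ => hFf.f_nonneg i x).1 hx i (Finset.mem_univ i)

theorem IsSolution.pointwise {N m : ℕ} {F : Fin m → E N → E N → ℝ} {f : Fin m → E N → ℝ}
    {D : E N → Matrix (Fin m) (Fin m) ℝ} (hD : IsCoupling D) (hFf : IsStructured F f) {l : ℝ}
    {c : Fin m → ℝ} {u : E N → Fin m → ℝ} (hu : IsSolution (hamiltonian F f) D l c u) (x : E N)
    (i : Fin m) : l * u x i + ∑ j, D x i j * u x j ≤ f i x + c i := by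
  obtain ⟨B, -, hB⟩ := ZPeriodic.exists_bound (g := fun i x => u x i)
    (fun j => (continuous_apply j).comp hu.continuous) (fun i => hu.sub.periodic.apply i)
  exact SubTest.pointwise hFf.F_nonneg hFf.continuous_f hD.continuous hu.continuous
    (fun x i => hB i x) hu.sub.test x i

theorem IsDiscountedSolution.nonneg {N m : ℕ} {F : Fin m → E N → E N → ℝ} {f : Fin m → E N → ℝ}
    {D : E N → Matrix (Fin m) (Fin m) ℝ} (hD : IsCoupling D) (hFf : IsStructured F f) {l : ℝ}
    (hl : 0 < l) {u : E N → Fin m → ℝ} (hu : IsDiscountedSolution (hamiltonian F f) D l u)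
    (x : E N) (i : Fin m) : 0 ≤ u x i := by
  obtain ⟨w, hw, hw0⟩ := exists_isDiscountedSolution hD hFf hl
  rw [IsDiscountedSolution.unique hD hFf hl hu hw]
  exact hw0 x i

/-- The solution of the discounted system vanishes where all the `f_i` do: there the algebraic
inequality reads `(l + D) u ≤ 0`, and `u ≥ 0`. -/
theorem IsDiscountedSolution.eq_zero_of_mem_zeroSet {N m : ℕ} {F : Fin m → E N → E N → ℝ}
    {f : Fin m → E N → ℝ} {D : E N → Matrix (Fin m) (Fin m) ℝ} (hD : IsCoupling D)
    (hFf : IsStructured F f) {l : ℝ} (hl : 0 < l) {u : E N → Fin m → ℝ}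
    (hu : IsDiscountedSolution (hamiltonian F f) D l u) {x : E N} (hx : x ∈ zeroSet f) :
    u x = 0 := by
  have h0 := IsDiscountedSolution.nonneg hD hFf hl hu x
  funext i
  have : Nonempty (Fin m) := ⟨i⟩
  obtain ⟨i₁, hi₁⟩ := Finite.exists_max (u x)
  have h1 := IsSolution.pointwise hD hFf hu x i₁
  have h2 := hD.sum_mul_nonneg x hi₁ (h0 i₁)
  rw [f_eq_zero_of_mem_zeroSet hFf hx] at h1
  simp only [Pi.zero_apply, add_zero] at h1
  have h3 : u x i₁ ≤ 0 := by
    by_contra! h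
    nlinarith [mul_pos hl h]
  exact le_antisymm ((hi₁ i).trans h3) (h0 i)

/-- Lipschitz estimate, uniform in the discount factor: the algebraic inequality `D u ≤ f` and
irreducibility bound the differences `u_i - u_j`, hence the coupling term from below. -/
theorem exists_lipschitzWith_isDiscountedSolution {N m : ℕ} {F : Fin m → E N → E N → ℝ}
    {f : Fin m → E N → ℝ} {D : E N → Matrix (Fin m) (Fin m) ℝ} (hD : IsCoupling D)
    (hirr : ∀ x, IsIrreducibleMatrix (D x)) (hFf : IsStructured F f) :
    ∃ K, ∀ l, 0 < l → ∀ u, IsDiscountedSolution (hamiltonian F f) D l u → LipschitzWith K u := by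
  obtain ⟨Bf, hBf0, hBf⟩ := ZPeriodic.exists_bound hFf.continuous_f hFf.periodic_f
  obtain ⟨Bd, hBd0, hBd⟩ := ZPeriodic.exists_bound (g := fun (q : Fin m × Fin m) x => D x q.1 q.2)
    (fun q => hD.continuous q.1 q.2) (fun q => hD.periodic q.1 q.2)
  obtain ⟨C, hC0, hC⟩ := hD.exists_osc_bound hirr
  obtain ⟨R, hR⟩ := exists_gradient_bound hFf (C := Bf + m * (Bd * (C * Bf))) (by positivity)
  refine ⟨Real.toNNReal (max R 0 + 1), fun l hl u hu => LipschitzWith.of_dist_le_mul fun x y => ?_⟩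
  refine (dist_pi_le_iff (by positivity)).2 fun i => ?_
  refine LipschitzWith.dist_le_mul (f := fun x => u x i) ?_ x y
  obtain ⟨B, -, hB⟩ := ZPeriodic.exists_bound (g := fun i x => u x i)
    (fun j => (continuous_apply j).comp hu.continuous) (fun i => hu.sub.periodic.apply i)
  have h0 := IsDiscountedSolution.nonneg hD hFf hl hu
  refine SubTest.lipschitzWith hu.sub.test hu.continuous (fun x i => hB i x) (le_max_right _ _)
    (fun i x p hp => (hR i x p hp).trans (le_max_left _ _)) (fun x i => ?_) i
  have hosc := hC x (u x) Bf (h0 x) hBf0 fun k => by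
    have h1 := IsSolution.pointwise hD hFf hu x k
    simp only [Pi.zero_apply, add_zero] at h1
    linarith [mul_nonneg hl.le (h0 x k), (abs_le.1 (hBf k x)).2]
  have h1 : ∑ j, D x i j * (u x i - u x j) ≤ ∑ _j : Fin m, Bd * (C * Bf) := by
    refine Finset.sum_le_sum fun j _ => ?_
    refine (le_abs_self _).trans ?_
    rw [abs_mul]
    exact mul_le_mul (hBd (i, j) x) (abs_le.2 ⟨by linarith [hosc j i], hosc i j⟩)
      (abs_nonneg _) hBd0
  simp only [mul_sub, Finset.sum_sub_distrib, ← Finset.sum_mul, Finset.sum_const,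
    Finset.card_univ, Fintype.card_fin, nsmul_eq_mul] at h1
  simp only [Pi.zero_apply]
  linarith [(abs_le.1 (hBf i x)).2, mul_nonneg hl.le (h0 x i),
    mul_nonneg (hD.rowSum_nonneg x i) (h0 x i)]

/-- Arzelà–Ascoli for periodic functions: compactness on a fixed ball, transported to the whole
space by `fractPoint`. -/
theorem exists_subseq_tendstoUniformly {N m : ℕ} {v : ℕ → E N → Fin m → ℝ}
    (hp : ∀ n, ZPeriodic (v n)) {K : NNReal} (hK : ∀ n, LipschitzWith K (v n)) {B : ℝ}
    (hB : ∀ n x, ‖v n x‖ ≤ B) :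
    ∃ (s : ℕ → ℕ) (w : E N → Fin m → ℝ), StrictMono s ∧
      TendstoUniformly (fun n => v (s n)) w atTop ∧ LipschitzWith K w ∧ ZPeriodic w := by
  let X := Metric.closedBall (0 : E N) √N
  have : CompactSpace X := isCompact_iff_compactSpace.1 (isCompact_closedBall _ _)
  let g : ℕ → BoundedContinuousFunction X (Fin m → ℝ) := fun n =>
    BoundedContinuousFunction.mkOfCompact
      ⟨fun x : X => v n x, (hK n).continuous.comp continuous_subtype_val⟩
  have hcomp : IsCompact (closure (Set.range g)) := by
    refine BoundedContinuousFunction.arzela_ascoli (Metric.closedBall 0 B)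
      (isCompact_closedBall _ _) _ ?_ ?_
    · rintro _ x ⟨n, rfl⟩
      exact mem_closedBall_zero_iff.2 (hB n x)
    · refine (LipschitzWith.uniformEquicontinuous _ K ?_).equicontinuous
      rintro ⟨_, n, rfl⟩
      exact (hK n).comp (LipschitzWith.subtype_val _) |>.weaken (by simp)
  obtain ⟨G, -, s, hs, hlim⟩ := hcomp.tendsto_subseq (x := g)
    fun n => subset_closure (Set.mem_range_self n)
  have hunif := BoundedContinuousFunction.tendsto_iff_tendstoUniformly.1 hlim
  let proj : E N → X := fun x => ⟨fractPoint x, fractPoint_mem x⟩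
  have hw : TendstoUniformly (fun n => v (s n)) (fun x => G (proj x)) atTop := by
    have h1 : (fun n => v (s n)) = fun n => g (s n) ∘ proj :=
      funext₂ fun n x => ((hp (s n)).fractPoint_eq x).symm
    rw [h1]
    exact hunif.comp proj
  refine ⟨s, _, hs, hw, LipschitzWith.of_dist_le_mul fun x y => ?_, fun x k => ?_⟩
  · exact le_of_tendsto' ((hw.tendsto_at x).dist (hw.tendsto_at y))
      fun n => (hK (s n)).dist_le_mul x y
  · refine tendsto_nhds_unique (hw.tendsto_at _) ?_
    simp only [hp (_) x k]
    exact hw.tendsto_at x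

/-- Vanishing discount limit: since the discounted solutions vanish on the zero set, they are
uniformly bounded, and along subsequences converge to solutions of the ergodic system with
constant zero. -/
theorem exists_subseq_vanishing_discount {N m : ℕ} {F : Fin m → E N → E N → ℝ}
    {f : Fin m → E N → ℝ} {D : E N → Matrix (Fin m) (Fin m) ℝ} (hD : IsCoupling D)
    (hirr : ∀ x, IsIrreducibleMatrix (D x)) (hFf : IsStructured F f) {xs : E N}
    (hxs : xs ∈ zeroSet f) {l : ℕ → ℝ} (hl : ∀ n, 0 < l n) (hl0 : Tendsto l atTop (𝓝 0))
    {v : ℕ → E N → Fin m → ℝ}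
    (hv : ∀ n, IsDiscountedSolution (hamiltonian F f) D (l n) (v n)) :
    ∃ (s : ℕ → ℕ) (w : E N → Fin m → ℝ), StrictMono s ∧
      TendstoUniformly (fun n x => -(l (s n) • v (s n) x)) (fun _ => 0) atTop ∧
      TendstoUniformly (fun n => v (s n)) w atTop ∧
      IsErgodicSolution (hamiltonian F f) D 0 w ∧ (∃ K, LipschitzWith K w) ∧
      ∀ x ∈ zeroSet f, w x = 0 := by
  obtain ⟨K, hK⟩ := exists_lipschitzWith_isDiscountedSolution hD hirr hFf
  have hzero : ∀ n, ∀ x ∈ zeroSet f, v n x = 0 := fun n x hx =>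
    IsDiscountedSolution.eq_zero_of_mem_zeroSet hD hFf (hl n) (hv n) hx
  have hB : ∀ n x, ‖v n x‖ ≤ K * (√N + ‖xs‖) := by
    intro n x
    rw [← (hv n).sub.periodic.fractPoint_eq x]
    have h1 := (hK (l n) (hl n) (v n) (hv n)).dist_le_mul (fractPoint x) xs
    rw [hzero n xs hxs, dist_zero_right, dist_eq_norm] at h1
    refine h1.trans (mul_le_mul_of_nonneg_left ?_ K.coe_nonneg)
    exact (norm_sub_le _ _).trans (add_le_add_left (norm_fractPoint_le x) _)
  obtain ⟨s, w, hs, hw, hwK, hwp⟩ := exists_subseq_tendstoUniformly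
    (fun n => (hv n).sub.periodic) (fun n => hK (l n) (hl n) (v n) (hv n)) hB
  have hls : Tendsto (fun n => l (s n)) atTop (𝓝 0) := hl0.comp hs.tendsto_atTop
  refine ⟨s, w, hs, ?_, hw, ?_, ⟨K, hwK⟩, fun x hx => ?_⟩
  · rw [Metric.tendstoUniformly_iff]
    intro ε hε
    have h1 : Tendsto (fun n => l (s n) * (K * (√N + ‖xs‖))) atTop (𝓝 0) := by
      simpa using hls.mul_const _
    filter_upwards [h1.eventually_lt_const hε] with n hn x
    rw [dist_zero_left, norm_neg, norm_smul, Real.norm_of_nonneg (hl _).le]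
    exact (mul_le_mul_of_nonneg_left (hB _ x) (hl _).le).trans_lt hn
  · refine IsSolution.of_tests hwK.continuous hwp ?_ ?_
    · exact SubTest.of_tendstoUniformly hFf.continuous_hamiltonian hD.continuous hls
        (fun n => (hv (s n)).continuous) hwK.continuous hw fun n => (hv (s n)).sub.test
    · exact SuperTest.of_tendstoUniformly hFf.continuous_hamiltonian hD.continuous hls
        (fun n => (hv (s n)).continuous) hwK.continuous hw fun n => (hv (s n)).super.test
  · refine tendsto_nhds_unique (hw.tendsto_at x) ?_
    simp only [hzero _ x hx]
    exact tendsto_const_nhds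

/-! ### Uniqueness of the ergodic constant -/

/-- Vectors in the kernel of all the `D(x)` with a positive component are constant, and force the
row sums of `D(x)` to vanish. -/
theorem IsCoupling.const_of_mulVec_eq_zero {N m : ℕ} {D : E N → Matrix (Fin m) (Fin m) ℝ}
    (hD : IsCoupling D) (hirr : ∀ x, IsIrreducibleMatrix (D x)) {c : Fin m → ℝ}
    (hc : ∀ x, (D x).mulVec c = 0) {k : Fin m} (hk : 0 < c k) :
    ∃ κ, 0 < κ ∧ (∀ j, c j = κ) ∧ ∀ x i, ∑ j, D x i j = 0 := by
  have : Nonempty (Fin m) := ⟨k⟩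
  have hc' : ∀ x i, ∑ j, D x i j * c j = 0 := fun x i => congrFun (hc x) i
  obtain ⟨i₁, hi₁⟩ := Finite.exists_max c
  have hpos : 0 < c i₁ := hk.trans_le (hi₁ k)
  have hconst : ∀ j, c j = c i₁ := by
    intro j
    by_contra hj
    obtain ⟨i, hi⟩ := hD.exists_sum_mul_pos (hirr 0) hi₁ hpos.le hj
    exact hi.ne' (hc' 0 i)
  refine ⟨c i₁, hpos, hconst, fun x i => ?_⟩
  have h1 := hc' x i
  simp only [hconst, ← Finset.sum_mul] at h1
  exact (mul_eq_zero.1 h1).resolve_right hpos.ne'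

/-- The ergodic constant in the common kernel is zero. A positive one is excluded by the
supersolution inequality at a global minimum, a negative one by the algebraic subsolution
inequality at a point of the zero set. -/
theorem IsErgodicSolution.eq_zero_of_mulVec_eq_zero {N m : ℕ} {F : Fin m → E N → E N → ℝ}
    {f : Fin m → E N → ℝ} {D : E N → Matrix (Fin m) (Fin m) ℝ} (hD : IsCoupling D)
    (hirr : ∀ x, IsIrreducibleMatrix (D x)) (hFf : IsStructured F f) (hne : (zeroSet f).Nonempty)
    {c : Fin m → ℝ} (hc : ∀ x, (D x).mulVec c = 0) {w : E N → Fin m → ℝ}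
    (hw : IsErgodicSolution (hamiltonian F f) D c w) : c = 0 := by
  funext k
  have hnonempty : Nonempty (Fin m) := ⟨k⟩
  refine le_antisymm ?_ ?_
  · by_contra! hk
    obtain ⟨κ, hκ, hcκ, hrow⟩ := hD.const_of_mulVec_eq_zero hirr hc hk
    have hex := fun i => ZPeriodic.exists_min ((continuous_apply i).comp hw.continuous)
      (hw.sub.periodic.apply i)
    choose y hy using hex
    obtain ⟨i, hi⟩ := Finite.exists_min fun i => w (y i) i
    have h1 := hw.super.test i (fun _ => 0) (y i) contDiff_const
      (Eventually.of_forall fun z => by simpa using hy i z)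
    have h2 := hD.rowSum_mul_le (y i) (a := fun j => -w (y i) j) (i := i)
      (fun j => neg_le_neg ((hi j).trans (hy j (y i))))
    rw [hrow, zero_mul] at h2
    simp only [mul_neg, Finset.sum_neg_distrib] at h2
    simp only [gradient_fun_const, hamiltonian, hFf.F_zero, hcκ] at h1
    linarith [hFf.f_nonneg i (y i)]
  · by_contra! hk
    have hk' : 0 < (-c) k := by simpa using hk
    obtain ⟨κ, hκ, hcκ, hrow⟩ := hD.const_of_mulVec_eq_zero hirr (c := -c)
      (fun x => by rw [Matrix.mulVec_neg, hc, neg_zero]) hk'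
    obtain ⟨x, hx⟩ := hne
    obtain ⟨i, hi⟩ := Finite.exists_max (w x)
    have h1 := IsSolution.pointwise hD hFf hw x i
    have h2 := hD.rowSum_mul_le x hi
    rw [hrow, zero_mul] at h2
    rw [f_eq_zero_of_mem_zeroSet hFf hx] at h1
    have h3 : -c i = κ := hcκ i
    linarith

end HJSystem

theorem theorem4p2 {N m : ℕ}
    (D : HJSystem.E N → Matrix (Fin m) (Fin m) ℝ)
    (F : Fin m → HJSystem.E N → HJSystem.E N → ℝ) (f : Fin m → HJSystem.E N → ℝ)
    (hD : HJSystem.IsCoupling D)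
    (hirr : ∀ x, HJSystem.IsIrreducibleMatrix (D x))
    (hFf : HJSystem.IsStructured F f)
    (hne : (HJSystem.zeroSet f).Nonempty) :
    -- well-posedness of the discounted system
    (∀ l ∈ Set.Ioo (0 : ℝ) 1,
      ∃! u, HJSystem.IsDiscountedSolution (HJSystem.hamiltonian F f) D l u) ∧
    -- convergence along subsequences to a solution of the ergodic system
    (∀ v : ℝ → HJSystem.E N → Fin m → ℝ,
      (∀ l ∈ Set.Ioo (0 : ℝ) 1,
        HJSystem.IsDiscountedSolution (HJSystem.hamiltonian F f) D l (v l)) →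
      ∀ xs ∈ HJSystem.zeroSet f,
      ∀ l : ℕ → ℝ, (∀ n, l n ∈ Set.Ioo (0 : ℝ) 1) → Tendsto l atTop (𝓝 0) →
      ∃ (s : ℕ → ℕ) (c : Fin m → ℝ) (w : HJSystem.E N → Fin m → ℝ),
        StrictMono s ∧
        TendstoUniformly (fun n x => -(l (s n) • v (l (s n)) x)) (fun _ => c) atTop ∧
        TendstoUniformly (fun n x => v (l (s n)) x - v (l (s n)) xs) w atTop ∧
        HJSystem.IsErgodicSolution (HJSystem.hamiltonian F f) D c w ∧
        (∃ K, LipschitzWith K w) ∧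
        (∀ x, (D x).mulVec c = 0) ∧
        (∀ x ∈ HJSystem.zeroSet f, ∀ i, w x i = 0) ∧
        (∀ i, c i = 0)) ∧
    -- the zero vector is the unique ergodic constant in the common kernel of the `D(x)`
    (∀ c : Fin m → ℝ,
      ((∀ x, (D x).mulVec c = 0) ∧
        ∃ w, HJSystem.IsErgodicSolution (HJSystem.hamiltonian F f) D c w) ↔ c = 0) := by
  have hexist : ∀ l ∈ Set.Ioo (0 : ℝ) 1, ∃ u,
      HJSystem.IsDiscountedSolution (HJSystem.hamiltonian F f) D l u := fun l hl => by
    obtain ⟨u, hu, -⟩ := HJSystem.exists_isDiscountedSolution hD hFf hl.1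
    exact ⟨u, hu⟩
  refine ⟨fun l hl => ?_, fun v hv xs hxs l hl hl0 => ?_, fun c => ⟨?_, ?_⟩⟩
  · obtain ⟨u, hu⟩ := hexist l hl
    exact ⟨u, hu, fun w hw => HJSystem.IsDiscountedSolution.unique hD hFf hl.1 hw hu⟩
  · obtain ⟨s, w, hs, hlv, hvw, hw, hK, hw0⟩ := HJSystem.exists_subseq_vanishing_discount hD hirr
      hFf hxs (fun n => (hl n).1) hl0 (fun n => hv (l n) (hl n))
    refine ⟨s, 0, w, hs, hlv, ?_, hw, hK, fun x => Matrix.mulVec_zero _,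
      fun x hx i => congrFun (hw0 x hx) i, fun i => rfl⟩
    have h0 : ∀ n, v (l (s n)) xs = 0 := fun n =>
      HJSystem.IsDiscountedSolution.eq_zero_of_mem_zeroSet hD hFf (hl (s n)).1
        (hv _ (hl (s n))) hxs
    simpa only [h0, sub_zero] using hvw
  · rintro ⟨hc, w, hw⟩
    exact HJSystem.IsErgodicSolution.eq_zero_of_mulVec_eq_zero hD hirr hFf hne hc hw
  · rintro rfl
    refine ⟨fun x => Matrix.mulVec_zero _, ?_⟩
    obtain ⟨xs, hxs⟩ := hne
    -- Any sequence of discount factors in `(0, 1)` tending to `0` produces an ergodic solution.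
    -- Any sequence of discount factors in `(0, 1)` tending to `0` produces an ergodic solution.
    have hl : ∀ n : ℕ, 1 / ((n : ℝ) + 1 + 1) ∈ Set.Ioo (0 : ℝ) 1 := fun n => by
      have hn : (0 : ℝ) ≤ n := n.cast_nonneg
      exact ⟨by positivity, (div_lt_one (by positivity)).2 (by linarith)⟩
    choose v hv using fun n => hexist _ (hl n)
    have hl0 : Tendsto (fun n : ℕ => 1 / ((n : ℝ) + 1 + 1)) atTop (𝓝 0) := by
      simpa [Function.comp_def] using
        (tendsto_one_div_add_atTop_nhds_zero_nat (𝕜 := ℝ)).comp (tendsto_add_atTop_nat 1)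
    obtain ⟨-, w, -, -, -, hw, -⟩ := HJSystem.exists_subseq_vanishing_discount hD hirr hFf hxs
      (fun n => (hl n).1) hl0 hv
    exact ⟨w, hw⟩
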